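/- Let $m\ge 2$. Let $\mathbb S_m=\mathbb C^{2^{\lfloor m/2\rfloor}}$ be the spin module with its standard hermitian norm and let $\alpha_1,\dots,\alpha_m$ be skew-hermitian matrices on $\mathbb S_m$ with $\alpha_j\alpha_k+\alpha_k\alpha_j=-2\delta_{jk}$. Write $x\cdot\psi=\sum_k x_k\alpha_k\psi$ for Clifford multiplication and $D=\sum_k\alpha_k\,\partial/\partial x_k$ for the Dirac operator on $\mathbb R^m$. Let $E(\mathbb R^m)$ be the set of spinor fields on $\mathbb R^m\setminus\{0\}$ of the form $$\psi(x)=f_1(|x|)\gamma+\frac{f_2(|x|)}{|x|}\,x\cdot\gamma,\qquad f_1,f_2\in C^\infty((0,\infty),\mathbb R),\ \gamma\in\mathbb S_m,\ |\gamma|=1 .$$ Put $H(u,v)=-\frac{m-1}{2}uv+\frac{m-1}{2m}(u^2+v^2)^{m/(m-1)}$ and $I=\left[-\frac{(m-1)^m}{2^{m+1}m},\infty\right)\setminus\{0\}$. For a unit spinor $\gamma$ and $\mu\in I$ let $\mathfrak S_\gamma(\mu)$ be the set of spinor fields of the above form with $$f_1(r)=-u(t)e^{\frac{m-1}{2}t},\qquad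 f_2(r)=v(t)e^{\frac{m-1}{2}t},\qquad r=e^{-t},$$ where $(u,v):\mathbb R\to\mathbb R^2$ is a periodic solution (constant ones included) of $$u'+\tfrac{m-1}{2}u=(u^2+v^2)^{\frac1{m-1}}v,\qquad -v'+\tfrac{m-1}{2}v=(u^2+v^2)^{\frac1{m-1}}u$$ with energy $H(u,v)=\mu$. Then the equation $$D\psi=|\psi|^{\frac{2}{m-1}}\psi\quad\text{on }\mathbb R^m\setminus\{0\}\qquad(*)$$ has a one-parameter family of singular solutions in $E(\mathbb R^m)$ parameterized by $I$, in the following sense. 1. For every unit spinor $\gamma$ and every $\mu\in I$ the set $\mathfrak S_\gamma(\mu)$ is non-empty, and every $\psi\in\mathfrak S_\gamma(\mu)$ belongs to $E(\mathbb R^m)$, is a smooth solution of $(*)$, satisfies $|\psi(x)|\to\infty$ as $x\to0$ and $\psi(x)\neq0$ for all $x\ne0$, and satisfies $|\psi(x)|=O(|x|^{-\frac{m-1}{2}})$ both as $|x|\to\infty$ and as $|x|\to0$. 2. The parameter is determined by the solution: if $|\gamma|=|\gamma'|=1$, $\mu,\mu'\in I$ and $\psi\in\mathfrak S_\gamma(\mu)\cap\mathfrak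 S_{\gamma'}(\mu')$, then $\mu=\mu'$. Conversely, $\mu$ determines the solution up to sign and dilation: if $\mu\in I$, $|\gamma|=1$ and $\psi,\psi'\in\mathfrak S_\gamma(\mu)$, then there are $\sigma\in\{1,-1\}$ and $\rho>0$ with $\psi'(x)=\sigma\rho^{\frac{m-1}{2}}\psi(\rho x)$ for all $x\neq0$. 3. For every spinor $\gamma_0$ with $|\gamma_0|=\frac1{\sqrt2}\left(\frac m2\right)^{\frac{m-1}{2}}$ and every $\lambda>0$ one can choose $\psi_\mu\in\mathfrak S_{\gamma_0/|\gamma_0|}(\mu)$, $\mu\in I$, such that, as $\mu\to0$ through negative values, $\psi_\mu$ converges in $C^1_{loc}(\mathbb R^m\setminus\{0\})$ to $$\psi_\infty(x)=\lambda^{\frac12}\left(\frac{2\lambda}{\lambda^2+|x|^2}\right)^{\frac m2}\left(1-\frac{x}{\lambda}\right)\cdot\gamma_0 .$$ -/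

import Mathlib

open Filter Topology Set
open scoped ContDiff

namespace SpinorialYamabe

/-- Euclidean space `ℝ^m`. -/
abbrev Eucl (m : ℕ) : Type := EuclideanSpace ℝ (Fin m)

/-- The spin module `𝕊_m ≅ ℂ^(2^⌊m/2⌋)` with its standard hermitian norm. -/
abbrev Spinor (m : ℕ) : Type := EuclideanSpace ℂ (Fin (2 ^ (m / 2)))

/-- A matrix realisation of Clifford multiplication on the spin module of `ℝ^m`: the skew-hermitian
matrices `α_1, …, α_m` of the standard basis vectors, of size `2^⌊m/2⌋` (the dimension of an
irreducible complex Clifford module), with `α_j α_k + α_k α_j = -2 δ_jk`.  Such matrices exist for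
every `m`, see `SpinRep.nonempty`. -/
structure SpinRep (m : ℕ) where
  /-- Clifford multiplication by the `k`-th basis vector. -/
  α : Fin m → Matrix (Fin (2 ^ (m / 2))) (Fin (2 ^ (m / 2))) ℂ
  /-- Clifford relations. -/
  clifford : ∀ j k, α j * α k + α k * α j = if j = k then (-2 : ℂ) • 1 else 0
  /-- Clifford multiplication by a vector is skew-hermitian. -/
  skew : ∀ j, (α j).conjTranspose = -α j

/-- The usual recursive block construction of Clifford matrices. -/
theorem exists_clifford_matrices (n : ℕ) :
    ∃ A : ℕ → Matrix (Fin (2 ^ n)) (Fin (2 ^ n)) ℂ,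
      (∀ j k, j < 2 * n + 1 → k < 2 * n + 1 →
        A j * A k + A k * A j = if j = k then (-2 : ℂ) • 1 else 0) ∧
      (∀ j, j < 2 * n + 1 → (A j).conjTranspose = -A j) := by
  induction n with
  | zero =>
    refine ⟨fun _ => Complex.I • 1, ?_, ?_⟩
    · intro j k hj hk
      obtain rfl : j = 0 := by omega
      obtain rfl : k = 0 := by omega
      rw [if_pos rfl]
      simp only [Matrix.smul_mul, Matrix.mul_smul, smul_smul, one_mul, Complex.I_mul_I, ← add_smul]
      norm_num
    · intro j _
      simp [Matrix.conjTranspose_smul]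
  | succ n ih =>
    obtain ⟨A, hA, hs⟩ := ih
    let e : Fin (2 ^ n) ⊕ Fin (2 ^ n) ≃ Fin (2 ^ (n + 1)) :=
      finSumFinEquiv.trans (finCongr (by rw [pow_succ]; omega))
    let B : ℕ → Matrix (Fin (2 ^ n) ⊕ Fin (2 ^ n)) (Fin (2 ^ n) ⊕ Fin (2 ^ n)) ℂ := fun j =>
      if j < 2 * n + 1 then Matrix.fromBlocks 0 (-(Complex.I • A j)) (Complex.I • A j) 0
      else if j = 2 * n + 1 then Matrix.fromBlocks 0 (Complex.I • 1) (Complex.I • 1) 0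
      else Matrix.fromBlocks (-(Complex.I • 1)) 0 0 (Complex.I • 1)
    have b1 : ∀ j, j < 2 * n + 1 →
        B j = Matrix.fromBlocks 0 (-(Complex.I • A j)) (Complex.I • A j) 0 := fun j hj => if_pos hj
    have b2 : B (2 * n + 1) = Matrix.fromBlocks 0 (Complex.I • 1) (Complex.I • 1) 0 := by
      simp only [B, lt_irrefl, if_false, if_true]
    have b3 : B (2 * n + 2) = Matrix.fromBlocks (-(Complex.I • 1)) 0 0 (Complex.I • 1) := by
      simp only [B]
      rw [if_neg (by omega), if_neg (by omega)]
    have h2 : ((-2 : ℂ) • (1 : Matrix (Fin (2 ^ n) ⊕ Fin (2 ^ n)) (Fin (2 ^ n) ⊕ Fin (2 ^ n)) ℂ))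
        = Matrix.fromBlocks ((-2 : ℂ) • 1) 0 0 ((-2 : ℂ) • 1) := by
      rw [← Matrix.fromBlocks_one, Matrix.fromBlocks_smul, smul_zero]
    have hII : -((1 : Matrix (Fin (2 ^ n)) (Fin (2 ^ n)) ℂ)) + -1 = (-2 : ℂ) • 1 := by
      rw [show (-2 : ℂ) = -1 + -1 by norm_num, add_smul, neg_one_smul]
    have hB : ∀ j k, j < 2 * n + 3 → k < 2 * n + 3 →
        B j * B k + B k * B j = if j = k then (-2 : ℂ) • 1 else 0 := by
      intro j k hj hk
      rcases (by omega : j < 2 * n + 1 ∨ j = 2 * n + 1 ∨ j = 2 * n + 2) with h | h | h <;>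
      rcases (by omega : k < 2 * n + 1 ∨ k = 2 * n + 1 ∨ k = 2 * n + 2) with h' | h' | h'
      · have := hA j k h h'
        rw [b1 j h, b1 k h']
        split_ifs with hjk
        · rw [if_pos hjk] at this
          rw [h2]
          simp [Matrix.fromBlocks_multiply, Matrix.fromBlocks_add, smul_smul, this]
        · rw [if_neg hjk] at this
          simp [Matrix.fromBlocks_multiply, Matrix.fromBlocks_add, smul_smul, this]
      · subst h'
        rw [b1 j h, b2, if_neg (by omega)]
        simp [Matrix.fromBlocks_multiply, Matrix.fromBlocks_add, smul_smul]
      · subst h'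
        rw [b1 j h, b3, if_neg (by omega)]
        simp [Matrix.fromBlocks_multiply, Matrix.fromBlocks_add, smul_smul]
      · subst h
        rw [b1 k h', b2, if_neg (by omega)]
        simp [Matrix.fromBlocks_multiply, Matrix.fromBlocks_add, smul_smul]
      · subst h h'
        rw [b2, if_pos rfl, h2]
        simp [Matrix.fromBlocks_multiply, Matrix.fromBlocks_add, smul_smul, hII]
      · subst h h'
        rw [b2, b3, if_neg (by omega)]
        simp [Matrix.fromBlocks_multiply, Matrix.fromBlocks_add, smul_smul]
      · subst h
        rw [b1 k h', b3, if_neg (by omega)]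
        simp [Matrix.fromBlocks_multiply, Matrix.fromBlocks_add, smul_smul]
      · subst h h'
        rw [b2, b3, if_neg (by omega)]
        simp [Matrix.fromBlocks_multiply, Matrix.fromBlocks_add, smul_smul]
      · subst h h'
        rw [b3, if_pos rfl, h2]
        simp [Matrix.fromBlocks_multiply, Matrix.fromBlocks_add, smul_smul, hII]
    have hBs : ∀ j, j < 2 * n + 3 → (B j).conjTranspose = -B j := by
      intro j hj
      rcases (by omega : j < 2 * n + 1 ∨ j = 2 * n + 1 ∨ j = 2 * n + 2) with h | h | h
      · rw [b1 j h]
        simp [Matrix.fromBlocks_conjTranspose, Matrix.conjTranspose_smul, hs j h,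
          Matrix.fromBlocks_neg]
      · subst h
        rw [b2]
        simp [Matrix.fromBlocks_conjTranspose, Matrix.conjTranspose_smul, Matrix.fromBlocks_neg]
      · subst h
        rw [b3]
        simp [Matrix.fromBlocks_conjTranspose, Matrix.conjTranspose_smul, Matrix.fromBlocks_neg]
    refine ⟨fun j => Matrix.reindexAlgEquiv ℂ ℂ e (B j), ?_, ?_⟩
    · intro j k hj hk
      simp only []
      rw [← map_mul, ← map_mul, ← map_add, hB j k (by omega) (by omega)]
      split_ifs
      · rw [map_smul, map_one]
      · rw [map_zero]
    · intro j hj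
      simp only []
      rw [Matrix.coe_reindexAlgEquiv, Matrix.conjTranspose_reindex, hBs j (by omega)]
      rfl

theorem SpinRep.nonempty (m : ℕ) : Nonempty (SpinRep m) := by
  obtain ⟨A, hA, hs⟩ := exists_clifford_matrices (m / 2)
  refine ⟨⟨fun j => A j, fun j k => ?_, fun j => hs j (by omega)⟩⟩
  rw [hA j k (by omega) (by omega)]
  simp only [Fin.ext_iff]

noncomputable section

variable {m : ℕ}

/-- Clifford multiplication `x · ψ = ∑ₖ xₖ αₖ ψ` of a vector and a spinor. -/
def SpinRep.mul (S : SpinRep m) (x : Eucl m) (ψ : Spinor m) : Spinor m :=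
  ∑ k, (x k : ℂ) • Matrix.toEuclideanLin (S.α k) ψ

/-- The Euclidean Dirac operator `D = ∑ₖ αₖ ∂/∂xₖ`. -/
def SpinRep.dirac (S : SpinRep m) (ψ : Eucl m → Spinor m) (x : Eucl m) : Spinor m :=
  ∑ k, Matrix.toEuclideanLin (S.α k) (fderiv ℝ ψ x (EuclideanSpace.single k 1))

/-- `ψ` is a smooth solution of `D ψ = |ψ|^(2/(m-1)) ψ` on `ℝ^m ∖ {0}`. -/
def IsSolution (S : SpinRep m) (ψ : Eucl m → Spinor m) : Prop :=
  ContDiffOn ℝ ∞ ψ {0}ᶜ ∧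
    ∀ x, x ≠ 0 → S.dirac ψ x = (‖ψ x‖ ^ (2 / ((m : ℝ) - 1))) • ψ x

/-- The spinor field `f₁(|x|) γ + (f₂(|x|)/|x|) x · γ`. -/
def ansatz (S : SpinRep m) (γ : Spinor m) (f₁ f₂ : ℝ → ℝ) (x : Eucl m) : Spinor m :=
  f₁ ‖x‖ • γ + (f₂ ‖x‖ / ‖x‖) • S.mul x γ

/-- The ansatz space `E(ℝ^m)`; its elements are fields on `ℝ^m ∖ {0}`, the value at `0` is
immaterial. -/
def ansatzSpace (S : SpinRep m) : Set (Eucl m → Spinor m) :=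
  {ψ | ∃ f₁ f₂ : ℝ → ℝ, ContDiffOn ℝ ∞ f₁ (Ioi 0) ∧ ContDiffOn ℝ ∞ f₂ (Ioi 0) ∧
    ∃ γ : Spinor m, ‖γ‖ = 1 ∧ ∀ x, x ≠ 0 → ψ x = ansatz S γ f₁ f₂ x}

/-- The Hamiltonian `H(u,v) = -(m-1)/2 uv + (m-1)/(2m) (u²+v²)^(m/(m-1))`. -/
def hamiltonian (m : ℕ) (u v : ℝ) : ℝ :=
  -(((m : ℝ) - 1) / 2) * u * v
    + (((m : ℝ) - 1) / (2 * m)) * (u ^ 2 + v ^ 2) ^ ((m : ℝ) / ((m : ℝ) - 1))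

/-- `(u, v)` is a periodic solution on `ℝ`, of energy `H(u,v) = μ`, of the Hamiltonian system
`u' + (m-1)/2 u = (u²+v²)^(1/(m-1)) v`, `-v' + (m-1)/2 v = (u²+v²)^(1/(m-1)) u`. -/
structure IsPeriodicOrbit (m : ℕ) (μ : ℝ) (u v : ℝ → ℝ) : Prop where
  differentiable_u : Differentiable ℝ u
  differentiable_v : Differentiable ℝ v
  eq_u : ∀ t, deriv u t + ((m : ℝ) - 1) / 2 * u t
    = (u t ^ 2 + v t ^ 2) ^ (1 / ((m : ℝ) - 1)) * v t
  eq_v : ∀ t, -deriv v t + ((m : ℝ) - 1) / 2 * v t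
    = (u t ^ 2 + v t ^ 2) ^ (1 / ((m : ℝ) - 1)) * u t
  periodic : ∃ T > 0, Function.Periodic u T ∧ Function.Periodic v T
  energy : ∀ t, hamiltonian m (u t) (v t) = μ

/-- The Emden–Fowler change of variables: with `r = e^(-t)`, the profile `w` on the line gives the
radial function `f(r) = w(t) e^((m-1)t/2)`. -/
def emdenFowler (m : ℕ) (w : ℝ → ℝ) (r : ℝ) : ℝ :=
  w (-Real.log r) * Real.exp (((m : ℝ) - 1) / 2 * (-Real.log r))

/-- The Delaunay-type spinor fields with polarisation `γ` and parameter `μ`: the fields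
`f₁(|x|) γ + (f₂(|x|)/|x|) x · γ` on `ℝ^m ∖ {0}` with `f₁(r) = -u(t) e^((m-1)t/2)`,
`f₂(r) = v(t) e^((m-1)t/2)`, `r = e^(-t)`, for a periodic orbit `(u, v)` of energy `μ`. -/
def delaunayFamily (S : SpinRep m) (γ : Spinor m) (μ : ℝ) : Set (Eucl m → Spinor m) :=
  {ψ | ∃ u v : ℝ → ℝ, IsPeriodicOrbit m μ u v ∧
    ∀ x, x ≠ 0 → ψ x = ansatz S γ (fun r => -emdenFowler m u r) (emdenFowler m v) x}

/-- The parameter set `[-(m-1)^m / (2^(m+1) m), ∞) ∖ {0}`. -/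
def parameterSet (m : ℕ) : Set ℝ :=
  Ici (-(((m : ℝ) - 1) ^ m / (2 ^ (m + 1) * m))) \ {0}

/-- The bubble `λ^(1/2) (2λ/(λ²+|x|²))^(m/2) (1 - x/λ) · γ₀` of scale `l = λ`. -/
def bubble (S : SpinRep m) (l : ℝ) (γ₀ : Spinor m) (x : Eucl m) : Spinor m :=
  (Real.sqrt l * (2 * l / (l ^ 2 + ‖x‖ ^ 2)) ^ ((m : ℝ) / 2)) • (γ₀ - S.mul (l⁻¹ • x) γ₀)

/-- `C¹_loc` convergence on `Ω`: uniform convergence of the fields and of their first derivatives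
on every compact subset of `Ω`. -/
def TendstoC1Loc {ι : Type*} (Ψ : ι → Eucl m → Spinor m) (F : Filter ι)
    (ψ : Eucl m → Spinor m) (Ω : Set (Eucl m)) : Prop :=
  ∀ K ⊆ Ω, IsCompact K →
    TendstoUniformlyOn Ψ ψ F K ∧ TendstoUniformlyOn (fun i => fderiv ℝ (Ψ i)) (fderiv ℝ ψ) F K

end

end SpinorialYamabe

/-!
In the variable `t = -log |x|` a field of the ansatz space is `A(t) γ + B(t) x · γ`
(`logField`). As `x · x · γ = -|x|² γ` and `x · γ` is orthogonal to `γ`, its length and its image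
under the Dirac operator are explicit (`SpinRep.norm_smul_add_smul_mul_sq`,
`SpinRep.dirac_eq_of_hasFDerivAt`), and the equation becomes the planar Hamiltonian system for
`(u, v)`; moreover `|ψ(x)|² = |x|^(1-m) (u² + v²)`. Everything else is a statement about this system.

Put `ρ = u² + v²` and `y = ρ^(1/(m-1))`. The product `u v` is a function of `ρ` and the energy, and
`ρ' = (m-1)(v² - u²)`, so an orbit is governed by the zeros of `v² - u²`. On the diagonal `u = v` the
energy is the polynomial `diagonalEnergy m y`, strictly increasing for `y ≥ (m-1)/2` with its
minimum, the least value in the parameter set, at the equilibria `y = (m-1)/2`.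

* A periodic orbit of energy `μ ≠ 0` takes its maximal `ρ` at a point of the diagonal with
  `y ≥ (m-1)/2` (`IsOrbit.exists_max`). Hence `ρ`, and so `|ψ|`, determines `μ`, and `μ` determines
  the orbit up to sign and time translation, that is, the field up to sign and dilation.
* Conversely the orbit through such a point of the diagonal is periodic
  (`IsOrbit.isPeriodicOrbit_of_diagonal`). The system is reversible under `(u, v)(t) ↦ ±(v, u)(-t)`,
  so a second zero of `v² - u²` gives a period. Without one, `ρ` would be monotone, hence convergent,
  and the limit would be an equilibrium; then the energy is minimal and the orbit is constant.
* The level `μ = 0` carries an explicit homoclinic orbit, whose field is the bubble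
  (`homoclinic_isOrbit`, `bubble_eq_logField`). It starts on the diagonal at `y = m/2`, and the
  starting points of the orbits of energy `μ < 0` converge to it as `μ → 0`. Grönwall's inequality
  then gives locally uniform convergence of the orbits, and the system that of their derivatives.
-/

namespace SpinorialYamabe

/-! ### Autonomous differential equations -/

section ODE

variable {E : Type*} [NormedAddCommGroup E] [NormedSpace ℝ E]

/-- Grönwall's inequality for two global solutions, in both directions of time. -/
theorem dist_le_mul_exp_abs_of_hasDerivAt {X : E → E} {s : Set E} {K : NNReal}
    (hX : LipschitzOnWith K X s) {z w : ℝ → E} (hz : ∀ t, HasDerivAt z (X (z t)) t)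
    (hzs : ∀ t, z t ∈ s) (hw : ∀ t, HasDerivAt w (X (w t)) t) (hws : ∀ t, w t ∈ s) (t : ℝ) :
    dist (z t) (w t) ≤ dist (z 0) (w 0) * Real.exp (K * |t|) := by
  rcases le_total 0 t with ht | ht
  · have := dist_le_of_trajectories_ODE_of_mem (v := fun _ => X) (s := fun _ => s) (K := K)
      (f := z) (g := w) (a := 0) (b := t) (δ := dist (z 0) (w 0)) (fun _ _ => hX)
      (fun x _ => (hz x).continuousAt.continuousWithinAt)
      (fun x _ => (hz x).hasDerivWithinAt) (fun x _ => hzs x)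
      (fun x _ => (hw x).continuousAt.continuousWithinAt)
      (fun x _ => (hw x).hasDerivWithinAt) (fun x _ => hws x) le_rfl t ⟨ht, le_rfl⟩
    rw [sub_zero] at this
    rwa [abs_of_nonneg ht]
  · have key : ∀ {y : ℝ → E}, (∀ t, HasDerivAt y (X (y t)) t) →
        ∀ x, HasDerivAt (fun x => y (-x)) (-X (y (-x))) x := by
      intro y hy x
      have := (hy (-x)).scomp x (hasDerivAt_neg x)
      rwa [neg_one_smul] at this
    have := dist_le_of_trajectories_ODE_of_mem (v := fun _ x => -X x) (s := fun _ => s) (K := K)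
      (f := fun x => z (-x)) (g := fun x => w (-x)) (a := 0) (b := -t)
      (δ := dist (z 0) (w 0)) (fun _ _ => hX.neg)
      (fun x _ => (key hz x).continuousAt.continuousWithinAt)
      (fun x _ => (key hz x).hasDerivWithinAt) (fun x _ => hzs _)
      (fun x _ => (key hw x).continuousAt.continuousWithinAt)
      (fun x _ => (key hw x).hasDerivWithinAt) (fun x _ => hws _) (by simp) (-t)
      ⟨by linarith, le_rfl⟩
    simp only [sub_zero, neg_neg] at this
    rwa [abs_of_nonpos ht]

/-- A bounded vector field that is Lipschitz on every ball has global integral curves: the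
Picard–Lindelöf theorem applies on `[-n, n]` for each `n`, and the local solutions agree. -/
theorem exists_forall_hasDerivAt_of_bounded [CompleteSpace E] {X : E → E}
    (hlip : ∀ R : ℝ, ∃ K : NNReal, LipschitzOnWith K X (Metric.closedBall 0 R))
    {L : ℝ} (hL : ∀ z, ‖X z‖ ≤ L) (z₀ : E) :
    ∃ z : ℝ → E, z 0 = z₀ ∧ ∀ t, HasDerivAt z (X (z t)) t := by
  have hloc : ∀ n : ℕ, ∃ α : ℝ → E, α 0 = z₀ ∧
      ∀ t ∈ Ioo (-(n : ℝ)) n, HasDerivAt α (X (α t)) t := by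
    intro n
    set a : NNReal := ⟨|L| * n, by positivity⟩ with ha
    obtain ⟨K, hK⟩ := hlip (‖z₀‖ + a)
    have h0 : (0 : ℝ) ∈ Icc (-(n : ℝ)) n := by constructor <;> simp
    have hP : IsPicardLindelof (fun _ => X) (⟨0, h0⟩ : Icc (-(n : ℝ)) n) z₀ a 0 ⟨|L|, abs_nonneg _⟩
        K := by
      refine IsPicardLindelof.of_time_independent (fun x _ => (hL x).trans (le_abs_self L))
        (hK.mono ?_) ?_
      · intro x hx
        rw [mem_closedBall_iff_norm] at hx
        rw [mem_closedBall_zero_iff]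
        calc ‖x‖ = ‖z₀ + (x - z₀)‖ := by rw [add_sub_cancel]
          _ ≤ ‖z₀‖ + ‖x - z₀‖ := norm_add_le _ _
          _ ≤ _ := by gcongr
      · simp only [sub_zero, zero_sub, neg_neg, max_self, NNReal.coe_zero]
        exact le_rfl
    obtain ⟨α, h1, h2⟩ := hP.exists_eq_forall_mem_Icc_hasDerivWithinAt₀
    exact ⟨α, h1, fun t ht => (h2 t (Ioo_subset_Icc_self ht)).hasDerivAt (Icc_mem_nhds ht.1 ht.2)⟩
  choose α hα0 hα using hloc
  have hagree : ∀ n k : ℕ, n ≤ k → ∀ t : ℝ, |t| < n → α n t = α k t := by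
    intro n k hnk t ht
    obtain ⟨b, hb1, hb2⟩ := exists_between ht
    have hb0 : 0 < b := (abs_nonneg t).trans_lt hb1
    have hsub : ∀ {j : ℕ}, n ≤ j → Icc (-b) b ⊆ Ioo (-(j : ℝ)) j := by
      intro j hj x hx
      have : (n : ℝ) ≤ j := by exact_mod_cast hj
      exact ⟨by linarith [hx.1], by linarith [hx.2]⟩
    have hc : ∀ {j : ℕ}, n ≤ j → ContinuousOn (α j) (Icc (-b) b) := fun {j} hj x hx =>
      (hα j x (hsub hj hx)).continuousAt.continuousWithinAt
    obtain ⟨R₁, hR₁⟩ := isCompact_Icc.exists_bound_of_continuousOn (hc le_rfl)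
    obtain ⟨R₂, hR₂⟩ := isCompact_Icc.exists_bound_of_continuousOn (hc hnk)
    obtain ⟨K, hK⟩ := hlip (max R₁ R₂)
    have := ODE_solution_unique_of_mem_Ioo (v := fun _ => X) (K := K) (a := -b) (b := b) (t₀ := 0)
      (f := α n) (g := α k) (s := fun _ => Metric.closedBall 0 (max R₁ R₂)) (fun _ _ => hK)
      ⟨by linarith, hb0⟩
      (fun x hx => ⟨hα n x (hsub le_rfl (Ioo_subset_Icc_self hx)),
        mem_closedBall_zero_iff.2 ((hR₁ x (Ioo_subset_Icc_self hx)).trans (le_max_left _ _))⟩)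
      (fun x hx => ⟨hα k x (hsub hnk (Ioo_subset_Icc_self hx)),
        mem_closedBall_zero_iff.2 ((hR₂ x (Ioo_subset_Icc_self hx)).trans (le_max_right _ _))⟩)
      (by rw [hα0, hα0])
    exact this (abs_lt.1 hb1)
  refine ⟨fun t => α (⌊|t|⌋₊ + 1) t, hα0 _, fun t => ?_⟩
  have hev : (fun t => α (⌊|t|⌋₊ + 1) t) =ᶠ[𝓝 t] α (⌊|t|⌋₊ + 1 + 1) := by
    have : ∀ᶠ x in 𝓝 t, |x| < (⌊|t|⌋₊ : ℝ) + 1 :=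
      continuous_abs.continuousAt.eventually_lt continuousAt_const (Nat.lt_floor_add_one _)
    filter_upwards [this] with x hx
    refine hagree _ _ ?_ x (by exact_mod_cast Nat.lt_floor_add_one |x|)
    have : ⌊|x|⌋₊ < ⌊|t|⌋₊ + 1 := (Nat.floor_lt (abs_nonneg _)).2 (by exact_mod_cast hx)
    omega
  have ht : t ∈ Ioo (-((⌊|t|⌋₊ + 1 + 1 : ℕ) : ℝ)) ((⌊|t|⌋₊ + 1 + 1 : ℕ) : ℝ) := by
    rw [mem_Ioo, ← abs_lt]
    push_cast
    linarith [Nat.lt_floor_add_one |t|]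
  have := (hα _ t ht).congr_of_eventuallyEq hev
  rwa [← hev.eq_of_nhds] at this

end ODE

/-- If `f` and its derivative both converge at infinity, the derivative converges to `0`. -/
theorem eq_zero_of_tendsto_of_tendsto_deriv {f f' : ℝ → ℝ} {L l : ℝ}
    (hf : ∀ t, HasDerivAt f (f' t) t) (hL : Tendsto f atTop (𝓝 L))
    (hl : Tendsto f' atTop (𝓝 l)) : l = 0 := by
  have hmv : ∀ t : ℝ, ∃ x, t < x ∧ f' x = f (t + 1) - f t := by
    intro t
    obtain ⟨x, hx, hx'⟩ := exists_hasDerivAt_eq_slope f f' (lt_add_one t)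
      (fun y _ => (hf y).continuousAt.continuousWithinAt) (fun y _ => hf y)
    exact ⟨x, hx.1, by rw [hx']; simp⟩
  choose x hx hx' using hmv
  have h1 : Tendsto (fun t => f' (x t)) atTop (𝓝 l) :=
    hl.comp (tendsto_atTop_mono (fun t => (hx t).le) tendsto_id)
  have h2 : Tendsto (fun t => f' (x t)) atTop (𝓝 (L - L)) := by
    simp only [hx']
    exact (hL.comp (tendsto_atTop_add_const_right _ 1 tendsto_id)).sub hL
  rw [sub_self] at h2
  exact tendsto_nhds_unique h1 h2

/-- A continuous periodic function attains its maximum. -/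
theorem exists_forall_le_of_periodic {f : ℝ → ℝ} (hf : Continuous f) {T : ℝ} (hT : 0 < T)
    (hp : Function.Periodic f T) : ∃ t₀, ∀ t, f t ≤ f t₀ := by
  obtain ⟨t₀, -, h⟩ := isCompact_Icc.exists_isMaxOn (s := Icc 0 T) ⟨0, le_rfl, hT.le⟩
    hf.continuousOn
  refine ⟨t₀, fun t => ?_⟩
  obtain ⟨y, hy, hy'⟩ := hp.exists_mem_Ico₀ hT t
  rw [hy']
  exact h (Ico_subset_Icc_self hy)

/-- A critical point with positive second derivative is not a maximum. -/
theorem not_isMax_of_hasDerivAt {f f' : ℝ → ℝ} {t₀ f'' : ℝ} (hf : ∀ t, HasDerivAt f (f' t) t)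
    (hf' : HasDerivAt f' f'' t₀) (hpos : 0 < f'') (hmax : ∀ t, f t ≤ f t₀) : False := by
  have hd : deriv f = f' := funext fun t => (hf t).deriv
  have h0 : deriv f t₀ = 0 := IsLocalMax.deriv_eq_zero (Eventually.of_forall hmax)
  have hmin : IsLocalMin f t₀ := isLocalMin_of_deriv_deriv_pos (by rw [hd, hf'.deriv]; exact hpos)
    h0 (hf t₀).continuousAt
  have hconst : f =ᶠ[𝓝 t₀] fun _ => f t₀ := by
    filter_upwards [hmin] with t ht using le_antisymm (hmax t) ht
  have : f' =ᶠ[𝓝 t₀] fun _ => 0 := by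
    rw [← hd]
    filter_upwards [hconst.eventuallyEq_nhds] with t ht
    rw [ht.deriv_eq, deriv_const]
  rw [← hf'.deriv, this.deriv_eq, deriv_const] at hpos
  exact lt_irrefl _ hpos

/-! ### The planar vector field -/

/-- The map `z ↦ |z|^p z` is Lipschitz on balls for every `p > 0`, which for `p < 1` is not seen
from the factor `|z|^p` alone; Bernoulli's inequality takes care of the radial direction. -/
theorem norm_rpow_smul_sub_le {E : Type*} [NormedAddCommGroup E] [NormedSpace ℝ E] {p R : ℝ}
    (hp : 0 < p) {z w : E} (hz : ‖z‖ ≤ R) (hw : ‖w‖ ≤ R) :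
    ‖‖z‖ ^ p • z - ‖w‖ ^ p • w‖ ≤ (p + 2) * R ^ p * ‖z - w‖ := by
  wlog h : ‖w‖ ≤ ‖z‖ generalizing z w
  · rw [norm_sub_rev, norm_sub_rev z]
    exact this hw hz (le_of_not_ge h)
  have hbern : ‖z‖ ^ p * ‖w‖ - ‖w‖ ^ p * ‖w‖ ≤ (p + 1) * ‖z‖ ^ p * (‖z‖ - ‖w‖) := by
    rcases (norm_nonneg z).eq_or_lt with h0 | h0
    · have : ‖w‖ = 0 := le_antisymm (h.trans h0.ge) (norm_nonneg _)
      simp [this, ← h0]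
    have hb := one_add_mul_self_le_rpow_one_add (s := ‖w‖ / ‖z‖ - 1) (p := p + 1)
      (by linarith [div_nonneg (norm_nonneg w) h0.le]) (by linarith)
    rw [add_sub_cancel, Real.div_rpow (norm_nonneg _) h0.le, Real.rpow_add_one' (norm_nonneg _)
      (by linarith), Real.rpow_add_one' h0.le (by linarith), le_div_iff₀ (by positivity)] at hb
    have hb' : ‖z‖ ^ p * ‖z‖ + (p + 1) * ‖z‖ ^ p * (‖w‖ - ‖z‖) ≤ ‖w‖ ^ p * ‖w‖ := by
      refine le_trans (le_of_eq ?_) hb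
      field_simp
    have : ‖z‖ ^ p * ‖w‖ ≤ ‖z‖ ^ p * ‖z‖ := by gcongr
    nlinarith
  have hmono : ‖w‖ ^ p ≤ ‖z‖ ^ p := by gcongr
  have hR : ‖z‖ ^ p ≤ R ^ p := by gcongr
  have hzw : ‖z‖ - ‖w‖ ≤ ‖z - w‖ := norm_sub_norm_le z w
  calc ‖‖z‖ ^ p • z - ‖w‖ ^ p • w‖ = ‖‖z‖ ^ p • (z - w) + (‖z‖ ^ p - ‖w‖ ^ p) • w‖ := by
        congr 1
        module
    _ ≤ ‖z‖ ^ p * ‖z - w‖ + (‖z‖ ^ p - ‖w‖ ^ p) * ‖w‖ := by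
        refine (norm_add_le _ _).trans (le_of_eq ?_)
        rw [norm_smul, norm_smul, Real.norm_of_nonneg (by positivity),
          Real.norm_of_nonneg (sub_nonneg.2 hmono)]
    _ ≤ ‖z‖ ^ p * ‖z - w‖ + (p + 1) * ‖z‖ ^ p * (‖z‖ - ‖w‖) := by linarith
    _ ≤ ‖z‖ ^ p * ‖z - w‖ + (p + 1) * ‖z‖ ^ p * ‖z - w‖ := by gcongr
    _ = (p + 2) * ‖z‖ ^ p * ‖z - w‖ := by ring
    _ ≤ _ := by gcongr

/-- The vector field of the Hamiltonian system in the complex coordinate `z = u + i v`, in which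
the system reads `z' = -(m-1)/2 z̄ - i |z|^(2/(m-1)) z`. -/
noncomputable def planarField (m : ℕ) (z : ℂ) : ℂ :=
  -(((m : ℝ) - 1) / 2) • (starRingEnd ℂ) z - Complex.I * (‖z‖ ^ (2 / ((m : ℝ) - 1)) • z)

theorem sq_add_sq_rpow {a : ℝ} (z : ℂ) : (z.re ^ 2 + z.im ^ 2) ^ a = ‖z‖ ^ (2 * a) := by
  rw [Real.rpow_mul (norm_nonneg z), Real.rpow_two, ← Complex.normSq_eq_norm_sq,
    Complex.normSq_apply, sq, sq]

theorem planarField_re (m : ℕ) (z : ℂ) : (planarField m z).re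
    = -(((m : ℝ) - 1) / 2) * z.re + (z.re ^ 2 + z.im ^ 2) ^ (1 / ((m : ℝ) - 1)) * z.im := by
  rw [sq_add_sq_rpow, mul_one_div]
  simp [planarField]

theorem planarField_im (m : ℕ) (z : ℂ) : (planarField m z).im
    = ((m : ℝ) - 1) / 2 * z.im - (z.re ^ 2 + z.im ^ 2) ^ (1 / ((m : ℝ) - 1)) * z.re := by
  rw [sq_add_sq_rpow, mul_one_div]
  simp [planarField]

theorem planarField_lipschitzOnWith {m : ℕ} (hm : 2 ≤ m) (R : ℝ) :
    ∃ K : NNReal, LipschitzOnWith K (planarField m) (Metric.closedBall 0 R) := by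
  have hm' : (2 : ℝ) ≤ m := by exact_mod_cast hm
  set p : ℝ := 2 / ((m : ℝ) - 1) with hpdef
  have hp : 0 < p := div_pos two_pos (by linarith)
  refine ⟨⟨((m : ℝ) - 1) / 2 + (p + 2) * |R| ^ p, ?_⟩, LipschitzOnWith.of_dist_le_mul ?_⟩
  · have : (0 : ℝ) ≤ ((m : ℝ) - 1) / 2 := by linarith
    positivity
  intro z hz w hw
  rw [mem_closedBall_zero_iff] at hz hw
  rw [dist_eq_norm, dist_eq_norm]
  calc ‖planarField m z - planarField m w‖
      = ‖-((((m : ℝ) - 1) / 2) • (starRingEnd ℂ) (z - w))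
          - Complex.I * (‖z‖ ^ p • z - ‖w‖ ^ p • w)‖ := by
        congr 1
        simp only [planarField, ← hpdef, map_sub, smul_sub, mul_sub, neg_smul]
        ring
    _ ≤ ‖(((m : ℝ) - 1) / 2) • (starRingEnd ℂ) (z - w)‖
          + ‖Complex.I * (‖z‖ ^ p • z - ‖w‖ ^ p • w)‖ := by
        refine (norm_sub_le _ _).trans_eq ?_
        rw [norm_neg]
    _ = ((m : ℝ) - 1) / 2 * ‖z - w‖ + ‖‖z‖ ^ p • z - ‖w‖ ^ p • w‖ := by
        rw [norm_smul, RCLike.norm_conj, norm_mul, Complex.norm_I, one_mul,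
          Real.norm_of_nonneg (by linarith)]
    _ ≤ ((m : ℝ) - 1) / 2 * ‖z - w‖ + (p + 2) * |R| ^ p * ‖z - w‖ := by
        gcongr
        exact norm_rpow_smul_sub_le hp (hz.trans (le_abs_self R)) (hw.trans (le_abs_self R))
    _ = _ := by
        change _ = (((m : ℝ) - 1) / 2 + (p + 2) * |R| ^ p) * _
        ring

/-- The energy with the power of `u² + v²` split off. -/
theorem hamiltonian_eq {m : ℕ} (hm : 2 ≤ m) (u v : ℝ) : hamiltonian m u v
    = -(((m : ℝ) - 1) / 2) * (u * v) + ((m : ℝ) - 1) / (2 * m) *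
      ((u ^ 2 + v ^ 2) * (u ^ 2 + v ^ 2) ^ (1 / ((m : ℝ) - 1))) := by
  have hm' : (2 : ℝ) ≤ m := by exact_mod_cast hm
  have h : (m : ℝ) / ((m : ℝ) - 1) = 1 / ((m : ℝ) - 1) + 1 := by
    have : (m : ℝ) - 1 ≠ 0 := by linarith
    field_simp
    ring
  have h0 : (0 : ℝ) < 1 / ((m : ℝ) - 1) := one_div_pos.2 (by linarith)
  rw [hamiltonian, h, Real.rpow_add_one' (by positivity) (by linarith)]
  ring

/-- The Hamiltonian is a first integral of any time change of the system. -/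
theorem hasDerivAt_hamiltonian_zero {m : ℕ} (hm : 2 ≤ m) {u v : ℝ → ℝ} {t k : ℝ}
    (hu : HasDerivAt u (k * (-(((m : ℝ) - 1) / 2) * u t
      + (u t ^ 2 + v t ^ 2) ^ (1 / ((m : ℝ) - 1)) * v t)) t)
    (hv : HasDerivAt v (k * (((m : ℝ) - 1) / 2 * v t
      - (u t ^ 2 + v t ^ 2) ^ (1 / ((m : ℝ) - 1)) * u t)) t) :
    HasDerivAt (fun t => hamiltonian m (u t) (v t)) 0 t := by
  have hm' : (2 : ℝ) ≤ m := by exact_mod_cast hm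
  have hm1 : (0 : ℝ) < (m : ℝ) - 1 := by linarith
  have he : (m : ℝ) / ((m : ℝ) - 1) - 1 = 1 / ((m : ℝ) - 1) := by
    field_simp
    ring
  have h1 : HasDerivAt (fun t => (u t ^ 2 + v t ^ 2) ^ ((m : ℝ) / ((m : ℝ) - 1))) _ t :=
    ((hu.pow 2).add (hv.pow 2)).rpow_const (p := (m : ℝ) / ((m : ℝ) - 1))
      (Or.inr ((one_le_div hm1).2 (by linarith)))
  have h2 := ((hu.const_mul (-(((m : ℝ) - 1) / 2))).mul hv).add
    (h1.const_mul (((m : ℝ) - 1) / (2 * m)))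
  refine (h2.congr_deriv ?_)
  simp only [Pi.add_apply, Pi.pow_apply, he]
  field_simp
  ring

/-- Trajectories of bounded energy are bounded. -/
theorem sq_add_sq_le_of_hamiltonian {m : ℕ} (hm : 2 ≤ m) {u v μ : ℝ} (h : hamiltonian m u v = μ) :
    u ^ 2 + v ^ 2 ≤ max ((m : ℝ) ^ (m - 1)) (4 * |μ|) := by
  have hm' : (2 : ℝ) ≤ m := by exact_mod_cast hm
  by_contra! hlt
  obtain ⟨h1, h2⟩ := max_lt_iff.1 hlt
  rw [hamiltonian_eq hm] at h
  set ρ := u ^ 2 + v ^ 2 with hρ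
  have hy : (m : ℝ) ≤ ρ ^ (1 / ((m : ℝ) - 1)) := by
    calc (m : ℝ) = ((m : ℝ) ^ (m - 1)) ^ (1 / ((m : ℝ) - 1)) := by
          rw [← Real.rpow_natCast, ← Real.rpow_mul (by positivity), Nat.cast_sub (by omega),
            Nat.cast_one, mul_one_div_cancel (by linarith), Real.rpow_one]
      _ ≤ _ := by
          have : (0 : ℝ) ≤ 1 / ((m : ℝ) - 1) := one_div_nonneg.2 (by linarith)
          gcongr
  have huv : u * v ≤ ρ / 2 := by nlinarith [sq_nonneg (u - v)]
  have hρ0 : 0 ≤ ρ := by positivity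
  have hbig : ρ / 2 ≤ 1 / (m : ℝ) * (ρ * ρ ^ (1 / ((m : ℝ) - 1))) - ρ / 2 := by
    have : ρ = 1 / (m : ℝ) * (ρ * m) := by field_simp
    have h3 : 1 / (m : ℝ) * (ρ * m) ≤ 1 / (m : ℝ) * (ρ * ρ ^ (1 / ((m : ℝ) - 1))) := by gcongr
    linarith
  have key : ((m : ℝ) - 1) / 2 * (ρ / 2) ≤ μ := by
    rw [← h]
    calc ((m : ℝ) - 1) / 2 * (ρ / 2)
        ≤ ((m : ℝ) - 1) / 2 * (1 / (m : ℝ) * (ρ * ρ ^ (1 / ((m : ℝ) - 1))) - u * v) := by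
          have : (0 : ℝ) ≤ ((m : ℝ) - 1) / 2 := by linarith
          gcongr
          linarith
      _ = _ := by
          field_simp
          ring
  nlinarith [le_abs_self μ]

/-! ### Orbits of the Hamiltonian system -/

/-- A solution on `ℝ` of energy `μ` of the Hamiltonian system, solved for the derivatives and with
no periodicity required. -/
structure IsOrbit (m : ℕ) (μ : ℝ) (u v : ℝ → ℝ) : Prop where
  hasDerivAt_u : ∀ t, HasDerivAt u (-(((m : ℝ) - 1) / 2) * u t
    + (u t ^ 2 + v t ^ 2) ^ (1 / ((m : ℝ) - 1)) * v t) t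
  hasDerivAt_v : ∀ t, HasDerivAt v (((m : ℝ) - 1) / 2 * v t
    - (u t ^ 2 + v t ^ 2) ^ (1 / ((m : ℝ) - 1)) * u t) t
  energy : ∀ t, hamiltonian m (u t) (v t) = μ

theorem IsPeriodicOrbit.isOrbit {m : ℕ} {μ : ℝ} {u v : ℝ → ℝ} (h : IsPeriodicOrbit m μ u v) :
    IsOrbit m μ u v where
  hasDerivAt_u t := (h.differentiable_u t).hasDerivAt.congr_deriv (by linarith [h.eq_u t])
  hasDerivAt_v t := (h.differentiable_v t).hasDerivAt.congr_deriv (by linarith [h.eq_v t])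
  energy := h.energy

namespace IsOrbit

variable {m : ℕ} {μ : ℝ} {u v : ℝ → ℝ}

theorem isPeriodicOrbit (h : IsOrbit m μ u v) {T : ℝ} (hT : 0 < T)
    (hu : Function.Periodic u T) (hv : Function.Periodic v T) : IsPeriodicOrbit m μ u v where
  differentiable_u t := (h.hasDerivAt_u t).differentiableAt
  differentiable_v t := (h.hasDerivAt_v t).differentiableAt
  eq_u t := by rw [(h.hasDerivAt_u t).deriv]; ring
  eq_v t := by rw [(h.hasDerivAt_v t).deriv]; ring
  periodic := ⟨T, hT, hu, hv⟩
  energy := h.energy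

theorem continuous_u (h : IsOrbit m μ u v) : Continuous u :=
  continuous_iff_continuousAt.2 fun t => (h.hasDerivAt_u t).continuousAt

theorem continuous_v (h : IsOrbit m μ u v) : Continuous v :=
  continuous_iff_continuousAt.2 fun t => (h.hasDerivAt_v t).continuousAt

theorem neg (h : IsOrbit m μ u v) : IsOrbit m μ (fun t => -u t) (fun t => -v t) where
  hasDerivAt_u t := (h.hasDerivAt_u t).neg.congr_deriv (by simp only [neg_sq]; ring)
  hasDerivAt_v t := (h.hasDerivAt_v t).neg.congr_deriv (by simp only [neg_sq]; ring)
  energy t := by rw [← h.energy t]; simp [hamiltonian]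

theorem comp_add_const (h : IsOrbit m μ u v) (τ : ℝ) :
    IsOrbit m μ (fun t => u (t + τ)) (fun t => v (t + τ)) where
  hasDerivAt_u t := (h.hasDerivAt_u (t + τ)).comp_add_const t τ
  hasDerivAt_v t := (h.hasDerivAt_v (t + τ)).comp_add_const t τ
  energy t := h.energy (t + τ)

/-- The system is reversible: exchanging the unknowns and reversing time preserves it. -/
theorem reflect (h : IsOrbit m μ u v) : IsOrbit m μ (fun t => v (-t)) (fun t => u (-t)) where
  hasDerivAt_u t := by
    have := (h.hasDerivAt_v (-t)).scomp t (hasDerivAt_neg t)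
    refine HasDerivAt.congr_deriv this ?_
    simp only [smul_eq_mul, add_comm (v (-t) ^ 2)]
    ring
  hasDerivAt_v t := by
    have := (h.hasDerivAt_u (-t)).scomp t (hasDerivAt_neg t)
    refine HasDerivAt.congr_deriv this ?_
    simp only [smul_eq_mul, add_comm (v (-t) ^ 2)]
    ring
  energy t := by
    rw [← h.energy (-t), hamiltonian, hamiltonian, add_comm (v (-t) ^ 2)]
    ring

theorem hasDerivAt_complex (h : IsOrbit m μ u v) (t : ℝ) :
    HasDerivAt (fun t => (⟨u t, v t⟩ : ℂ)) (planarField m ⟨u t, v t⟩) t := by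
  have h1 := ((h.hasDerivAt_u t).ofReal_comp).add
    (((h.hasDerivAt_v t).ofReal_comp).mul_const Complex.I)
  have h2 : (fun t => (⟨u t, v t⟩ : ℂ)) = fun t => (u t : ℂ) + (v t : ℂ) * Complex.I :=
    funext fun t => Complex.mk_eq_add_mul_I _ _
  rw [h2]
  refine HasDerivAt.congr_deriv h1 ?_
  rw [← Complex.re_add_im (planarField m _), planarField_re, planarField_im]

theorem norm_le (hm : 2 ≤ m) (h : IsOrbit m μ u v) (t : ℝ) {R : ℝ}
    (hR : max ((m : ℝ) ^ (m - 1)) (4 * |μ|) ≤ R) : ‖(⟨u t, v t⟩ : ℂ)‖ ≤ Real.sqrt R := by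
  refine Real.le_sqrt_of_sq_le ?_
  rw [← Complex.normSq_eq_norm_sq, Complex.normSq_mk]
  nlinarith [sq_add_sq_le_of_hamiltonian hm (h.energy t)]

/-- Orbits of bounded energy stay in a common ball, so that they separate at most exponentially with
a common rate. -/
theorem dist_le (hm : 2 ≤ m) {R : ℝ} : ∃ K : NNReal, ∀ {μ μ' : ℝ} {u v u' v' : ℝ → ℝ},
    IsOrbit m μ u v → IsOrbit m μ' u' v' → |μ| ≤ R → |μ'| ≤ R → ∀ t,
    dist (⟨u t, v t⟩ : ℂ) ⟨u' t, v' t⟩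
      ≤ dist (⟨u 0, v 0⟩ : ℂ) ⟨u' 0, v' 0⟩ * Real.exp (K * |t|) := by
  obtain ⟨K, hK⟩ := planarField_lipschitzOnWith hm
    (Real.sqrt (max ((m : ℝ) ^ (m - 1)) (4 * R)))
  refine ⟨K, fun h h' hμ hμ' t => ?_⟩
  exact dist_le_mul_exp_abs_of_hasDerivAt hK h.hasDerivAt_complex
    (fun t => mem_closedBall_zero_iff.2 (h.norm_le hm t (by gcongr))) h'.hasDerivAt_complex
    (fun t => mem_closedBall_zero_iff.2 (h'.norm_le hm t (by gcongr))) t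

/-- Orbits are determined by their position at time `0`. -/
theorem unique (hm : 2 ≤ m) (h : IsOrbit m μ u v) {μ' : ℝ} {u' v' : ℝ → ℝ}
    (h' : IsOrbit m μ' u' v') (hu : u 0 = u' 0) (hv : v 0 = v' 0) (t : ℝ) :
    u t = u' t ∧ v t = v' t := by
  obtain ⟨K, hK⟩ := dist_le hm (R := max |μ| |μ'|)
  have := hK h h' (le_max_left _ _) (le_max_right _ _) t
  rw [hu, hv, dist_self, zero_mul, dist_le_zero] at this
  exact ⟨congrArg Complex.re this, congrArg Complex.im this⟩

/-- There is an orbit through every point of the plane. The vector field is multiplied by a cut-off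
function, equal to `1` on a ball that contains the energy level of the given point; this makes it
bounded, and does not affect the conservation of energy, so that the integral curve never leaves
the ball. -/
theorem exists_orbit (hm : 2 ≤ m) (a b : ℝ) :
    ∃ u v, u 0 = a ∧ v 0 = b ∧ IsOrbit m (hamiltonian m a b) u v := by
  set R := Real.sqrt (max ((m : ℝ) ^ (m - 1)) (4 * |hamiltonian m a b|)) with hRdef
  have hR : 0 ≤ R := Real.sqrt_nonneg _
  set χ : ℂ → ℝ := fun z => max 0 (1 - max 0 (‖z‖ - R)) with hχdef
  have hχ1 : ∀ z, χ z ≤ 1 := fun z => max_le zero_le_one (by linarith [le_max_left 0 (‖z‖ - R)])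
  have hχ0 : ∀ z, 0 ≤ χ z := fun z => le_max_left _ _
  have hχin : ∀ z, ‖z‖ ≤ R → χ z = 1 := fun z hz => by
    simp only [hχdef]
    rw [max_eq_left (by linarith : ‖z‖ - R ≤ 0)]
    norm_num
  have hχout : ∀ z, R + 1 ≤ ‖z‖ → χ z = 0 := fun z hz => by
    simp only [hχdef]
    rw [max_eq_right (by linarith : 0 ≤ ‖z‖ - R)]
    exact max_eq_left (by linarith)
  have hχlip : ∀ z w, |χ z - χ w| ≤ ‖z - w‖ := fun z w => by
    have e1 := abs_max_sub_max_le_abs (1 - max 0 (‖z‖ - R)) (1 - max 0 (‖w‖ - R)) 0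
    have e2 := abs_max_sub_max_le_abs (‖z‖ - R) (‖w‖ - R) 0
    have e3 := abs_norm_sub_norm_le z w
    simp only [hχdef]
    rw [max_comm 0 (1 - max 0 (‖z‖ - R)), max_comm 0 (1 - max 0 (‖w‖ - R))]
    refine e1.trans ?_
    rw [sub_sub_sub_cancel_left, abs_sub_comm, max_comm 0 (‖z‖ - R), max_comm 0 (‖w‖ - R)]
    refine e2.trans ?_
    rwa [sub_sub_sub_cancel_right]
  have hX0 : planarField m 0 = 0 := by simp [planarField]
  have hbd : ∀ (r : ℝ), ∃ B : ℝ, 0 ≤ B ∧ ∀ z : ℂ, ‖z‖ ≤ r → ‖planarField m z‖ ≤ B := by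
    intro r
    obtain ⟨K, hK⟩ := planarField_lipschitzOnWith hm |r|
    refine ⟨K * |r|, by positivity, fun z hz => ?_⟩
    have := hK.dist_le_mul z (mem_closedBall_zero_iff.2 (hz.trans (le_abs_self r))) 0
      (mem_closedBall_zero_iff.2 (by simp))
    rw [hX0, dist_zero_right, dist_zero_right] at this
    refine this.trans ?_
    gcongr
    exact hz.trans (le_abs_self r)
  obtain ⟨L, hL0, hL⟩ := hbd (R + 1)
  obtain ⟨z, hz0, hz⟩ := exists_forall_hasDerivAt_of_bounded (X := fun z => χ z • planarField m z)
    (fun r => by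
      obtain ⟨K, hK⟩ := planarField_lipschitzOnWith hm r
      obtain ⟨B, hB0, hB⟩ := hbd r
      refine ⟨K + ⟨B, hB0⟩, LipschitzOnWith.of_dist_le_mul fun x hx y hy => ?_⟩
      have h1 := hK.dist_le_mul x hx y hy
      have h2 := hB y (mem_closedBall_zero_iff.1 hy)
      rw [dist_eq_norm] at h1 ⊢
      have e : χ x • planarField m x - χ y • planarField m y
          = χ x • (planarField m x - planarField m y) + (χ x - χ y) • planarField m y := by
        module
      calc _ ≤ χ x * ‖planarField m x - planarField m y‖ + |χ x - χ y| * ‖planarField m y‖ := by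
            rw [e]
            refine (norm_add_le _ _).trans_eq ?_
            rw [norm_smul, norm_smul, Real.norm_of_nonneg (hχ0 x), Real.norm_eq_abs]
        _ ≤ 1 * (K * dist x y) + dist x y * B := by
            gcongr
            · exact hχ1 x
            · rw [dist_eq_norm]
              exact hχlip x y
        _ = (K + B) * dist x y := by ring)
    (L := L) (fun z => by
      rw [norm_smul, Real.norm_of_nonneg (hχ0 z)]
      rcases le_total ‖z‖ (R + 1) with h | h
      · calc χ z * ‖planarField m z‖ ≤ 1 * L := by
              gcongr
              · exact hχ1 z
              · exact hL z h
          _ = L := one_mul L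
      · rw [hχout z h, zero_mul]
        exact hL0) ⟨a, b⟩
  have hre : ∀ t, HasDerivAt (fun t => (z t).re) (χ (z t) * (planarField m (z t)).re) t := by
    intro t
    have := Complex.reCLM.hasFDerivAt.comp_hasDerivAt t (hz t)
    refine HasDerivAt.congr_deriv this ?_
    simp
  have him : ∀ t, HasDerivAt (fun t => (z t).im) (χ (z t) * (planarField m (z t)).im) t := by
    intro t
    have := Complex.imCLM.hasFDerivAt.comp_hasDerivAt t (hz t)
    refine HasDerivAt.congr_deriv this ?_
    simp
  simp only [planarField_re, planarField_im] at hre him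
  have hH : ∀ t, HasDerivAt (fun t => hamiltonian m (z t).re (z t).im) 0 t := fun t =>
    hasDerivAt_hamiltonian_zero hm (hre t) (him t)
  have hE : ∀ t, hamiltonian m (z t).re (z t).im = hamiltonian m a b := by
    intro t
    rw [is_const_of_deriv_eq_zero (fun t => (hH t).differentiableAt) (fun t => (hH t).deriv) t 0,
      hz0]
  have hχz : ∀ t, χ (z t) = 1 := by
    intro t
    refine hχin _ (Real.le_sqrt_of_sq_le ?_)
    have := sq_add_sq_le_of_hamiltonian hm (hE t)
    rwa [← Complex.normSq_eq_norm_sq, Complex.normSq_apply, ← sq, ← sq]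
  simp only [hχz, one_mul] at hre him
  exact ⟨fun t => (z t).re, fun t => (z t).im, by simp [hz0], by simp [hz0], hre, him, hE⟩

end IsOrbit

/-! ### Turning points and periodicity -/

/-- The energy of the points `u = v` of the diagonal with `u² + v² = y^(m-1)`. -/
noncomputable def diagonalEnergy (m : ℕ) (y : ℝ) : ℝ :=
  ((m : ℝ) - 1) / 2 * (y ^ m / m - y ^ (m - 1) / 2)

theorem pow_pred_rpow {m : ℕ} (hm : 2 ≤ m) {y : ℝ} (hy : 0 ≤ y) :
    (y ^ (m - 1)) ^ (1 / ((m : ℝ) - 1)) = y := by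
  have : (1 : ℝ) / ((m : ℝ) - 1) = (((m - 1 : ℕ) : ℝ))⁻¹ := by
    rw [Nat.cast_sub (by omega), Nat.cast_one, one_div]
  rw [this, Real.pow_rpow_inv_natCast hy (by omega)]

theorem rpow_pow_pred {m : ℕ} (hm : 2 ≤ m) {ρ : ℝ} (hρ : 0 ≤ ρ) :
    (ρ ^ (1 / ((m : ℝ) - 1))) ^ (m - 1) = ρ := by
  have : (1 : ℝ) / ((m : ℝ) - 1) = (((m - 1 : ℕ) : ℝ))⁻¹ := by
    rw [Nat.cast_sub (by omega), Nat.cast_one, one_div]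
  rw [this, Real.rpow_inv_natCast_pow hρ (by omega)]

theorem hamiltonian_diagonal {m : ℕ} (hm : 2 ≤ m) {y a : ℝ} (hy : 0 ≤ y)
    (ha : a ^ 2 = y ^ (m - 1) / 2) : hamiltonian m a a = diagonalEnergy m y := by
  have h2 : a ^ 2 + a ^ 2 = y ^ (m - 1) := by rw [ha]; ring
  have h3 : y ^ m = y ^ (m - 1) * y := by rw [← pow_succ]; congr 1; omega
  rw [hamiltonian_eq hm, h2, pow_pred_rpow hm hy, ← sq, ha, diagonalEnergy, h3]
  ring

theorem diagonalEnergy_strictMonoOn {m : ℕ} (hm : 2 ≤ m) :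
    StrictMonoOn (diagonalEnergy m) (Ici (((m : ℝ) - 1) / 2)) := by
  have hm' : (2 : ℝ) ≤ m := by exact_mod_cast hm
  have hd : ∀ y, HasDerivAt (diagonalEnergy m)
      (((m : ℝ) - 1) / 2 * y ^ (m - 2) * (y - ((m : ℝ) - 1) / 2)) y := by
    intro y
    have h := (((hasDerivAt_pow m y).div_const (m : ℝ)).sub
      ((hasDerivAt_pow (m - 1) y).div_const 2)).const_mul (((m : ℝ) - 1) / 2)
    refine HasDerivAt.congr_deriv h ?_
    have h1 : y ^ (m - 1) = y ^ (m - 2) * y := by rw [← pow_succ]; congr 1; omega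
    rw [h1, Nat.cast_sub (by omega), Nat.cast_one, Nat.sub_sub]
    field_simp
  refine strictMonoOn_of_deriv_pos (convex_Ici _)
    (fun y _ => (hd y).continuousAt.continuousWithinAt) ?_
  intro y hy
  rw [interior_Ici, mem_Ioi] at hy
  rw [(hd y).deriv]
  have : 0 < y := by linarith
  have : 0 < ((m : ℝ) - 1) / 2 := by linarith
  have : 0 < y - ((m : ℝ) - 1) / 2 := by linarith
  positivity

/-- The minimum of the energy on the diagonal is the left end point of the parameter set. -/
theorem diagonalEnergy_min {m : ℕ} (hm : 2 ≤ m) :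
    diagonalEnergy m (((m : ℝ) - 1) / 2) = -(((m : ℝ) - 1) ^ m / (2 ^ (m + 1) * m)) := by
  have hm' : (m : ℝ) ≠ 0 := by positivity
  obtain ⟨k, rfl⟩ : ∃ k, m = k + 1 := ⟨m - 1, by omega⟩
  rw [diagonalEnergy, Nat.add_sub_cancel]
  push_cast at hm' ⊢
  rw [div_pow, div_pow, add_sub_cancel_right]
  field_simp
  ring

theorem exists_diagonalEnergy_eq {m : ℕ} (hm : 2 ≤ m) {μ : ℝ} (hμ : μ ∈ parameterSet m) :
    ∃ y, ((m : ℝ) - 1) / 2 ≤ y ∧ diagonalEnergy m y = μ := by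
  have hm' : (2 : ℝ) ≤ m := by exact_mod_cast hm
  have hc : Continuous (diagonalEnergy m) := by
    unfold diagonalEnergy
    fun_prop
  -- for `y ≥ m` the energy is at least `y / 4`
  set Y : ℝ := m + 4 * |μ| with hY
  have hYm : (m : ℝ) ≤ Y := by linarith [abs_nonneg μ]
  have hbig : μ ≤ diagonalEnergy m Y := by
    have h1 : Y ≤ Y ^ (m - 1) := le_self_pow₀ (by linarith) (by omega)
    have h2 : Y ^ m = Y ^ (m - 1) * Y := by rw [← pow_succ]; congr 1; omega
    have h3 : 1 ≤ Y / m := (one_le_div (by linarith)).2 hYm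
    calc μ ≤ 1 / 2 * (Y * (1 / 2)) := by linarith [le_abs_self μ]
      _ ≤ ((m : ℝ) - 1) / 2 * (Y ^ (m - 1) * (Y / m - 1 / 2)) := by
          gcongr
          · linarith
          · linarith
          · linarith
      _ = _ := by
          rw [diagonalEnergy, h2]
          ring
  obtain ⟨y, hy, hy'⟩ := intermediate_value_Icc (by linarith : ((m : ℝ) - 1) / 2 ≤ Y)
    hc.continuousOn ⟨(diagonalEnergy_min hm).trans_le hμ.1, hbig⟩
  exact ⟨y, hy.1, hy'⟩

namespace IsOrbit

variable {m : ℕ} {μ : ℝ} {u v : ℝ → ℝ}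

theorem hasDerivAt_sq_add_sq (h : IsOrbit m μ u v) (t : ℝ) :
    HasDerivAt (fun t => u t ^ 2 + v t ^ 2) (((m : ℝ) - 1) * (v t ^ 2 - u t ^ 2)) t :=
  (((h.hasDerivAt_u t).pow 2).add ((h.hasDerivAt_v t).pow 2)).congr_deriv (by push_cast; ring)

theorem hasDerivAt_sq_sub_sq (h : IsOrbit m μ u v) (t : ℝ) :
    HasDerivAt (fun t => v t ^ 2 - u t ^ 2) (((m : ℝ) - 1) * (u t ^ 2 + v t ^ 2)
      - 4 * (u t ^ 2 + v t ^ 2) ^ (1 / ((m : ℝ) - 1)) * (u t * v t)) t :=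
  (((h.hasDerivAt_v t).pow 2).sub ((h.hasDerivAt_u t).pow 2)).congr_deriv (by push_cast; ring)

theorem sq_add_sq_pos (hm : 2 ≤ m) (h : IsOrbit m μ u v) (hμ : μ ≠ 0) (t : ℝ) :
    0 < u t ^ 2 + v t ^ 2 := by
  refine lt_of_le_of_ne (by positivity) fun h0 => hμ ?_
  have hu : u t = 0 := by nlinarith [sq_nonneg (u t), sq_nonneg (v t)]
  rw [← h.energy t, hamiltonian_eq hm, ← h0, hu]
  ring

/-- On an orbit, `u v` is a function of `u² + v²`. -/
theorem mul_eq (hm : 2 ≤ m) (h : IsOrbit m μ u v) (t : ℝ) : u t * v t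
    = 1 / (m : ℝ) * ((u t ^ 2 + v t ^ 2) * (u t ^ 2 + v t ^ 2) ^ (1 / ((m : ℝ) - 1)))
      - 2 / ((m : ℝ) - 1) * μ := by
  have hm' : (2 : ℝ) ≤ m := by exact_mod_cast hm
  have hm1 : (m : ℝ) - 1 ≠ 0 := by linarith
  have := h.energy t
  rw [hamiltonian_eq hm] at this
  rw [← this]
  field_simp
  ring

/-- The maximum of `u² + v²` over a periodic orbit is attained at a point of the diagonal beyond
the equilibrium, and is therefore determined by the energy. -/
theorem exists_max (hm : 2 ≤ m) (h : IsPeriodicOrbit m μ u v) (hμ : μ ≠ 0) :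
    ∃ t₀ y, ((m : ℝ) - 1) / 2 ≤ y ∧ u t₀ = v t₀ ∧ u t₀ ^ 2 = y ^ (m - 1) / 2 ∧
      diagonalEnergy m y = μ ∧ ∀ t, u t ^ 2 + v t ^ 2 ≤ u t₀ ^ 2 + v t₀ ^ 2 := by
  have hm' : (2 : ℝ) ≤ m := by exact_mod_cast hm
  have ho := h.isOrbit
  obtain ⟨T, hT, hu, hv⟩ := h.periodic
  obtain ⟨t₀, hmax⟩ := exists_forall_le_of_periodic (f := fun t => u t ^ 2 + v t ^ 2)
    ((ho.continuous_u.pow 2).add (ho.continuous_v.pow 2)) hT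
    (fun t => by simp only [hu t, hv t])
  have hpos := ho.sq_add_sq_pos hm hμ t₀
  set ρ := u t₀ ^ 2 + v t₀ ^ 2 with hρ
  have hq : 0 < ρ ^ (1 / ((m : ℝ) - 1)) := by positivity
  have hd : ((m : ℝ) - 1) * (v t₀ ^ 2 - u t₀ ^ 2) = 0 :=
    IsLocalMax.hasDerivAt_eq_zero (Eventually.of_forall hmax) (ho.hasDerivAt_sq_add_sq t₀)
  have hsq : v t₀ ^ 2 = u t₀ ^ 2 := by
    rcases mul_eq_zero.1 hd with h1 | h1 <;> linarith
  -- the second derivative of `u² + v²` at its maximum, up to the factor `m - 1`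
  have hdd : ((m : ℝ) - 1) * ρ - 4 * ρ ^ (1 / ((m : ℝ) - 1)) * (u t₀ * v t₀) ≤ 0 := by
    by_contra! hcon
    exact not_isMax_of_hasDerivAt ho.hasDerivAt_sq_add_sq
      ((ho.hasDerivAt_sq_sub_sq t₀).const_mul ((m : ℝ) - 1))
      (mul_pos (by linarith) hcon) hmax
  rcases sq_eq_sq_iff_eq_or_eq_neg.1 hsq with huv | huv
  · have h2 : u t₀ ^ 2 = ρ / 2 := by linarith
    have hy : ((m : ℝ) - 1) / 2 ≤ ρ ^ (1 / ((m : ℝ) - 1)) := by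
      rw [huv, ← sq, h2] at hdd
      by_contra! hlt
      nlinarith
    have h3 : u t₀ ^ 2 = (ρ ^ (1 / ((m : ℝ) - 1))) ^ (m - 1) / 2 := by
      rw [rpow_pow_pred hm hpos.le, h2]
    refine ⟨t₀, ρ ^ (1 / ((m : ℝ) - 1)), hy, huv.symm, h3, ?_, hmax⟩
    rw [← hamiltonian_diagonal hm hq.le h3, ← ho.energy t₀, huv]
  · exfalso
    rw [huv, mul_neg, ← sq] at hdd
    have : 0 < ((m : ℝ) - 1) * ρ := mul_pos (by linarith) hpos
    nlinarith [mul_nonneg hq.le (sq_nonneg (u t₀))]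

/-- An orbit issuing from the diagonal that meets one of the lines `u = v`, `u = -v` again is
periodic: both lines are fixed by a reversing symmetry. -/
theorem isPeriodicOrbit_of_sq_eq (hm : 2 ≤ m) (h : IsOrbit m μ u v) (h0 : u 0 = v 0) {T : ℝ}
    (hT : 0 < T) (hsq : v T ^ 2 = u T ^ 2) : IsPeriodicOrbit m μ u v := by
  have href : ∀ t, u t = v (-t) ∧ v t = u (-t) :=
    h.unique hm h.reflect (by simpa using h0) (by simpa using h0.symm)
  obtain ⟨σ, hσ, hvT, huT⟩ : ∃ σ : ℝ, σ * σ = 1 ∧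
      (∀ t, u (t + 2 * T) = σ * u t) ∧ ∀ t, v (t + 2 * T) = σ * v t := by
    have hshift := h.comp_add_const T
    rcases sq_eq_sq_iff_eq_or_eq_neg.1 hsq with hT' | hT'
    · have := hshift.unique hm hshift.reflect (by simp [hT']) (by simp [hT'])
      refine ⟨1, by norm_num, fun t => ?_, fun t => ?_⟩
      · have e := (this (t + T)).1
        have e' := (href (-t)).2
        rw [neg_neg] at e'
        rw [one_mul, ← e', show t + 2 * T = t + T + T by ring, e]
        congr 1
        ring
      · have e := (this (t + T)).2
        have e' := (href (-t)).1
        rw [neg_neg] at e'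
        rw [one_mul, ← e', show t + 2 * T = t + T + T by ring, e]
        congr 1
        ring
    · have := hshift.unique hm hshift.reflect.neg (by simp [hT']) (by simp [hT'])
      refine ⟨-1, by norm_num, fun t => ?_, fun t => ?_⟩
      · have e := (this (t + T)).1
        have e' := (href (-t)).2
        rw [neg_neg] at e'
        rw [neg_one_mul, ← e', show t + 2 * T = t + T + T by ring, e]
        congr 2
        ring
      · have e := (this (t + T)).2
        have e' := (href (-t)).1
        rw [neg_neg] at e'
        rw [neg_one_mul, ← e', show t + 2 * T = t + T + T by ring, e]
        congr 2
        ring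
  refine h.isPeriodicOrbit (T := 2 * T + 2 * T) (by positivity) (fun t => ?_) (fun t => ?_)
  · rw [← add_assoc, hvT, hvT, ← mul_assoc, hσ, one_mul]
  · rw [← add_assoc, huT, huT, ← mul_assoc, hσ, one_mul]

/-- If `u² + v²` converges along an orbit, the energy is that of the equilibria. -/
theorem energy_eq_of_tendsto (hm : 2 ≤ m) (h : IsOrbit m μ u v) (hμ : μ ≠ 0) {L s : ℝ}
    (hL : Tendsto (fun t => u t ^ 2 + v t ^ 2) atTop (𝓝 L))
    (hs : Tendsto (fun t => v t ^ 2 - u t ^ 2) atTop (𝓝 s)) :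
    μ = diagonalEnergy m (((m : ℝ) - 1) / 2) := by
  have hm' : (2 : ℝ) ≤ m := by exact_mod_cast hm
  have hm1 : (m : ℝ) - 1 ≠ 0 := by linarith
  have hq0 : (0 : ℝ) < 1 / ((m : ℝ) - 1) := one_div_pos.2 (by linarith)
  have hs0 : s = 0 := by
    have := eq_zero_of_tendsto_of_tendsto_deriv h.hasDerivAt_sq_add_sq hL (hs.const_mul _)
    exact (mul_eq_zero.1 this).resolve_left hm1
  subst hs0
  have hq : Tendsto (fun t => (u t ^ 2 + v t ^ 2) ^ (1 / ((m : ℝ) - 1))) atTop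
      (𝓝 (L ^ (1 / ((m : ℝ) - 1)))) := hL.rpow_const (Or.inr hq0.le)
  set Z : ℝ := 1 / (m : ℝ) * (L * L ^ (1 / ((m : ℝ) - 1))) - 2 / ((m : ℝ) - 1) * μ with hZ
  have hz : Tendsto (fun t => u t * v t) atTop (𝓝 Z) := by
    simp only [h.mul_eq hm]
    exact ((hL.mul hq).const_mul _).sub_const _
  have hd := eq_zero_of_tendsto_of_tendsto_deriv h.hasDerivAt_sq_sub_sq hs
    ((hL.const_mul _).sub ((hq.const_mul 4).mul hz))
  -- the limit of `(u² + v²)² = (v² - u²)² + 4 (u v)²`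
  have hLZ : L ^ 2 = 4 * Z ^ 2 := by
    have e1 : Tendsto (fun t => (u t ^ 2 + v t ^ 2) ^ 2) atTop (𝓝 (L ^ 2)) := hL.pow 2
    have e2 : Tendsto (fun t => (v t ^ 2 - u t ^ 2) ^ 2 + 4 * (u t * v t) ^ 2) atTop
        (𝓝 ((0 : ℝ) ^ 2 + 4 * Z ^ 2)) := (hs.pow 2).add ((hz.pow 2).const_mul 4)
    have e3 : (fun t => (v t ^ 2 - u t ^ 2) ^ 2 + 4 * (u t * v t) ^ 2)
        = fun t => (u t ^ 2 + v t ^ 2) ^ 2 := funext fun t => by ring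
    rw [e3] at e2
    rw [tendsto_nhds_unique e1 e2]
    ring
  have hL0 : 0 ≤ L := ge_of_tendsto' hL fun t => by positivity
  have hLpos : 0 < L := by
    refine lt_of_le_of_ne hL0 fun h0 => hμ ?_
    rw [← h0] at hLZ hZ
    have hZ0 : Z = 0 := by nlinarith [sq_nonneg Z]
    rw [hZ0] at hZ
    have : 2 / ((m : ℝ) - 1) * μ = 0 := by linarith
    exact (mul_eq_zero.1 this).resolve_left (by positivity)
  have hqL : 0 < L ^ (1 / ((m : ℝ) - 1)) := by positivity
  have hZpos : 0 < Z := by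
    by_contra! hcon
    have : 0 < ((m : ℝ) - 1) * L := mul_pos (by linarith) hLpos
    nlinarith [mul_nonneg hqL.le (neg_nonneg.2 hcon)]
  have hZL : Z = L / 2 := by nlinarith
  have hy : L ^ (1 / ((m : ℝ) - 1)) = ((m : ℝ) - 1) / 2 := by
    rw [hZL] at hd
    have : L * (((m : ℝ) - 1) - 2 * L ^ (1 / ((m : ℝ) - 1))) = 0 := by linarith
    have := (mul_eq_zero.1 this).resolve_left hLpos.ne'
    linarith
  have h1 : (((m : ℝ) - 1) / 2) ^ (m - 1) = L := by rw [← hy, rpow_pow_pred hm hL0]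
  have h2 : (((m : ℝ) - 1) / 2) ^ m = L * (((m : ℝ) - 1) / 2) := by
    rw [← h1, ← pow_succ]
    congr 1
    omega
  rw [diagonalEnergy, h1, h2]
  rw [hZL, hy] at hZ
  field_simp at hZ ⊢
  linarith

/-- An orbit through the diagonal is periodic. -/
theorem isPeriodicOrbit_of_diagonal (hm : 2 ≤ m) (h : IsOrbit m μ u v) (hμ : μ ≠ 0) {y : ℝ}
    (hy : ((m : ℝ) - 1) / 2 ≤ y) (h0 : u 0 = v 0) (hu0 : u 0 ^ 2 = y ^ (m - 1) / 2) :
    IsPeriodicOrbit m μ u v := by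
  have hm' : (2 : ℝ) ≤ m := by exact_mod_cast hm
  have hy0 : 0 ≤ y := by linarith
  by_cases hex : ∃ T > 0, v T ^ 2 = u T ^ 2
  · obtain ⟨T, hT, hsq⟩ := hex
    exact h.isPeriodicOrbit_of_sq_eq hm h0 hT hsq
  exfalso
  push Not at hex
  -- `s = v² - u²` has no zero on `(0, ∞)`, so `u² + v²` is monotone there and both converge
  have hmul : ∀ t, u t * v t = _ := h.mul_eq hm
  have hcont : Continuous fun t => v t ^ 2 - u t ^ 2 :=
    (h.continuous_v.pow 2).sub (h.continuous_u.pow 2)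
  have hsign : (∀ t > 0, 0 < v t ^ 2 - u t ^ 2) ∨ (∀ t > 0, v t ^ 2 - u t ^ 2 < 0) := by
    by_contra! hcon
    obtain ⟨⟨a, ha, ha'⟩, ⟨b, hb, hb'⟩⟩ := hcon
    obtain ⟨x, hx, hx0⟩ := (convex_Ioi (0 : ℝ)).isPreconnected.intermediate_value
      (mem_Ioi.2 ha) (mem_Ioi.2 hb) hcont.continuousOn ⟨ha', hb'⟩
    exact hex x hx (sub_eq_zero.1 hx0)
  have hbdd : ∀ t, u t ^ 2 + v t ^ 2 ≤ max ((m : ℝ) ^ (m - 1)) (4 * |μ|) := fun t =>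
    sq_add_sq_le_of_hamiltonian hm (h.energy t)
  have hcontρ : ContinuousOn (fun t => u t ^ 2 + v t ^ 2) (Ici 0) :=
    ((h.continuous_u.pow 2).add (h.continuous_v.pow 2)).continuousOn
  have hLex : ∃ L, Tendsto (fun t => u t ^ 2 + v t ^ 2) atTop (𝓝 L) := by
    rcases hsign with hs | hs
    · have hmono : MonotoneOn (fun t => u t ^ 2 + v t ^ 2) (Ici 0) :=
        monotoneOn_of_deriv_nonneg (convex_Ici 0) hcontρ
          (fun t _ => (h.hasDerivAt_sq_add_sq t).differentiableAt.differentiableWithinAt)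
          (fun t ht => by
            rw [interior_Ici] at ht
            rw [(h.hasDerivAt_sq_add_sq t).deriv]
            exact mul_nonneg (by linarith) (hs t ht).le)
      have hm2 : Monotone fun t => u (max t 0) ^ 2 + v (max t 0) ^ 2 := fun a b hab =>
        hmono (le_max_right a 0) (le_max_right b 0) (max_le_max_right 0 hab)
      refine ⟨_, (tendsto_atTop_ciSup hm2 ⟨max ((m : ℝ) ^ (m - 1)) (4 * |μ|), ?_⟩).congr' ?_⟩
      · rintro _ ⟨t, rfl⟩
        exact hbdd _
      · filter_upwards [eventually_ge_atTop 0] with t ht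
        rw [max_eq_left ht]
    · have hmono : AntitoneOn (fun t => u t ^ 2 + v t ^ 2) (Ici 0) :=
        antitoneOn_of_deriv_nonpos (convex_Ici 0) hcontρ
          (fun t _ => (h.hasDerivAt_sq_add_sq t).differentiableAt.differentiableWithinAt)
          (fun t ht => by
            rw [interior_Ici] at ht
            rw [(h.hasDerivAt_sq_add_sq t).deriv]
            exact mul_nonpos_of_nonneg_of_nonpos (by linarith) (hs t ht).le)
      have hm2 : Antitone fun t => u (max t 0) ^ 2 + v (max t 0) ^ 2 := fun a b hab =>
        hmono (le_max_right a 0) (le_max_right b 0) (max_le_max_right 0 hab)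
      refine ⟨_, (tendsto_atTop_ciInf hm2 ⟨0, ?_⟩).congr' ?_⟩
      · rintro _ ⟨t, rfl⟩
        positivity
      · filter_upwards [eventually_ge_atTop 0] with t ht
        rw [max_eq_left ht]
  obtain ⟨L, hL⟩ := hLex
  have hq0 : (0 : ℝ) ≤ 1 / ((m : ℝ) - 1) := one_div_nonneg.2 (by linarith)
  have hz : ∃ Z, Tendsto (fun t => u t * v t) atTop (𝓝 Z) := by
    simp only [hmul]
    exact ⟨_, ((hL.mul (hL.rpow_const (Or.inr hq0))).const_mul _).sub_const _⟩
  obtain ⟨Z, hZ⟩ := hz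
  have habs : Tendsto (fun t => |v t ^ 2 - u t ^ 2|) atTop (𝓝 (Real.sqrt (L ^ 2 - 4 * Z ^ 2))) := by
    have e : (fun t => |v t ^ 2 - u t ^ 2|)
        = fun t => Real.sqrt ((u t ^ 2 + v t ^ 2) ^ 2 - 4 * (u t * v t) ^ 2) := by
      funext t
      rw [← Real.sqrt_sq_eq_abs]
      congr 1
      ring
    rw [e]
    exact ((hL.pow 2).sub ((hZ.pow 2).const_mul 4)).sqrt
  have hs : ∃ s, Tendsto (fun t => v t ^ 2 - u t ^ 2) atTop (𝓝 s) := by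
    rcases hsign with hs | hs
    · refine ⟨_, habs.congr' ?_⟩
      filter_upwards [eventually_gt_atTop 0] with t ht using abs_of_pos (hs t ht)
    · refine ⟨_, habs.neg.congr' ?_⟩
      filter_upwards [eventually_gt_atTop 0] with t ht
      rw [abs_of_neg (hs t ht), neg_neg]
  obtain ⟨s, hs⟩ := hs
  -- the energy is minimal, so the orbit is an equilibrium, for which `s = 0`
  have hE : diagonalEnergy m y = μ := by
    rw [← hamiltonian_diagonal hm hy0 hu0, ← h.energy 0, h0]
  have hyc : y = ((m : ℝ) - 1) / 2 := (diagonalEnergy_strictMonoOn hm).injOn hy (self_mem_Ici)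
    (hE.trans (h.energy_eq_of_tendsto hm hμ hL hs))
  have hρ : u 0 ^ 2 + u 0 ^ 2 = y ^ (m - 1) := by rw [hu0]; ring
  have hconst : IsOrbit m μ (fun _ => u 0) (fun _ => u 0) :=
    ⟨fun t => (hasDerivAt_const t _).congr_deriv (by rw [hρ, pow_pred_rpow hm hy0, hyc]; ring),
      fun t => (hasDerivAt_const t _).congr_deriv (by rw [hρ, pow_pred_rpow hm hy0, hyc]; ring),
      fun t => by rw [← h.energy 0, h0]⟩
  have h1 := h.unique hm hconst rfl h0.symm 1
  exact hex 1 one_pos (by rw [h1.1, h1.2])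

end IsOrbit

/-- Every energy in the parameter set is realised by a periodic orbit issuing from the diagonal. -/
theorem exists_isPeriodicOrbit {m : ℕ} (hm : 2 ≤ m) {μ : ℝ} (hμ : μ ∈ parameterSet m) :
    ∃ y u v, ((m : ℝ) - 1) / 2 ≤ y ∧ diagonalEnergy m y = μ ∧ IsPeriodicOrbit m μ u v ∧
      u 0 = -Real.sqrt (y ^ (m - 1) / 2) ∧ v 0 = -Real.sqrt (y ^ (m - 1) / 2) := by
  have hm' : (2 : ℝ) ≤ m := by exact_mod_cast hm
  obtain ⟨y, hy, hE⟩ := exists_diagonalEnergy_eq hm hμ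
  have hy0 : 0 ≤ y := by linarith
  set a := -Real.sqrt (y ^ (m - 1) / 2) with ha
  have ha2 : a ^ 2 = y ^ (m - 1) / 2 := by rw [ha, neg_sq, Real.sq_sqrt (by positivity)]
  obtain ⟨u, v, hu, hv, ho⟩ := IsOrbit.exists_orbit hm a a
  rw [hamiltonian_diagonal hm hy0 ha2, hE] at ho
  exact ⟨y, u, v, hy, hE, ho.isPeriodicOrbit_of_diagonal hm hμ.2 hy (hu.trans hv.symm)
    (by rw [hu, ha2]), hu, hv⟩

/-- Periodic orbits of the same energy agree up to sign and translation in time. -/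
theorem IsPeriodicOrbit.eq_up_to_sign_and_translation {m : ℕ} (hm : 2 ≤ m) {μ : ℝ} (hμ : μ ≠ 0)
    {u v u' v' : ℝ → ℝ} (h : IsPeriodicOrbit m μ u v) (h' : IsPeriodicOrbit m μ u' v') :
    ∃ σ : ℝ, (σ = 1 ∨ σ = -1) ∧ ∃ τ : ℝ, ∀ t, u' t = σ * u (t + τ) ∧ v' t = σ * v (t + τ) := by
  obtain ⟨t₀, y, hy, huv, hu, hE, -⟩ := IsOrbit.exists_max hm h hμ
  obtain ⟨t₁, y', hy', huv', hu', hE', -⟩ := IsOrbit.exists_max hm h' hμ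
  have hyy : y = y' := (diagonalEnergy_strictMonoOn hm).injOn hy hy' (hE.trans hE'.symm)
  have hs : u' t₁ ^ 2 = u t₀ ^ 2 := by rw [hu, hu', hyy]
  have o1 := h'.isOrbit.comp_add_const t₁
  have o0 := h.isOrbit.comp_add_const t₀
  rcases sq_eq_sq_iff_eq_or_eq_neg.1 hs with hc | hc
  · refine ⟨1, Or.inl rfl, t₀ - t₁, fun t => ?_⟩
    have := o1.unique hm o0 (by simpa using hc) (by simpa [← huv, ← huv'] using hc) (t - t₁)
    rw [sub_add_cancel, show t - t₁ + t₀ = t + (t₀ - t₁) by ring] at this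
    simpa using this
  · refine ⟨-1, Or.inr rfl, t₀ - t₁, fun t => ?_⟩
    have := o1.unique hm o0.neg (by simpa using hc) (by simpa [← huv, ← huv'] using hc) (t - t₁)
    rw [sub_add_cancel, show t - t₁ + t₀ = t + (t₀ - t₁) by ring] at this
    simpa using this

/-! ### Clifford multiplication -/

namespace SpinRep

variable {m : ℕ} (S : SpinRep m)

theorem mul_eq_sum (x : Eucl m) (ψ : Spinor m) :
    S.mul x ψ = ∑ k, x k • Matrix.toEuclideanLin (S.α k) ψ := by
  simp only [SpinRep.mul, Complex.coe_smul]

/-- Clifford multiplication of a fixed spinor, as a real linear map in the vector. -/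
noncomputable def mulCLM (γ : Spinor m) : Eucl m →L[ℝ] Spinor m :=
  LinearMap.toContinuousLinearMap
    { toFun := fun x => S.mul x γ
      map_add' := fun x y => by
        simp only [mul_eq_sum, PiLp.add_apply, add_smul, Finset.sum_add_distrib]
      map_smul' := fun r x => by
        simp only [mul_eq_sum, PiLp.smul_apply, smul_eq_mul, mul_smul, Finset.smul_sum,
          RingHom.id_apply] }

@[simp]
theorem mulCLM_apply (γ : Spinor m) (x : Eucl m) : S.mulCLM γ x = S.mul x γ := rfl

theorem mul_smul_left (r : ℝ) (x : Eucl m) (γ : Spinor m) : S.mul (r • x) γ = r • S.mul x γ :=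
  (S.mulCLM γ).map_smul r x

theorem mul_add_right (x : Eucl m) (γ γ' : Spinor m) :
    S.mul x (γ + γ') = S.mul x γ + S.mul x γ' := by
  simp only [mul_eq_sum, map_add, smul_add, Finset.sum_add_distrib]

theorem mul_smul_right (x : Eucl m) (r : ℝ) (γ : Spinor m) :
    S.mul x (r • γ) = r • S.mul x γ := by
  simp only [mul_eq_sum, LinearMap.map_smul_of_tower, Finset.smul_sum]
  exact Finset.sum_congr rfl fun k _ => smul_comm _ _ _

theorem mul_single (k : Fin m) (γ : Spinor m) :
    S.mul (EuclideanSpace.single k 1) γ = Matrix.toEuclideanLin (S.α k) γ := by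
  rw [mul_eq_sum, Finset.sum_eq_single k]
  · simp
  · intro j _ hj
    simp [hj]
  · simp

theorem clifford_apply (j k : Fin m) (ψ : Spinor m) :
    Matrix.toEuclideanLin (S.α j) (Matrix.toEuclideanLin (S.α k) ψ)
      + Matrix.toEuclideanLin (S.α k) (Matrix.toEuclideanLin (S.α j) ψ)
      = if j = k then (-2 : ℝ) • ψ else 0 := by
  have h := congrArg (fun M => Matrix.toEuclideanLin M ψ) (S.clifford j k)
  simp only [map_add, Matrix.toLpLin_mul_same, LinearMap.add_apply, LinearMap.comp_apply] at h
  rw [h]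
  split_ifs
  · rw [map_smul, Matrix.toLpLin_one, LinearMap.smul_apply, LinearMap.id_apply]
    rw [show (-2 : ℂ) = ((-2 : ℝ) : ℂ) by norm_num, Complex.coe_smul]
  · simp

theorem sq_apply (k : Fin m) (ψ : Spinor m) :
    Matrix.toEuclideanLin (S.α k) (Matrix.toEuclideanLin (S.α k) ψ) = -ψ := by
  have h := S.clifford_apply k k ψ
  rw [if_pos rfl, ← two_smul ℝ, neg_smul, ← smul_neg] at h
  exact smul_right_injective _ (two_ne_zero (α := ℝ)) h

theorem mul_mul_self (x : Eucl m) (ψ : Spinor m) :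
    S.mul x (S.mul x ψ) = -(‖x‖ ^ 2) • ψ := by
  have hexp : S.mul x (S.mul x ψ) = ∑ j, ∑ k, (x j * x k) •
      Matrix.toEuclideanLin (S.α j) (Matrix.toEuclideanLin (S.α k) ψ) := by
    rw [mul_eq_sum]
    refine Finset.sum_congr rfl fun j _ => ?_
    rw [mul_eq_sum, map_sum, Finset.smul_sum]
    refine Finset.sum_congr rfl fun k _ => ?_
    rw [LinearMap.map_smul_of_tower, smul_smul]
  have hsym : (2 : ℝ) • S.mul x (S.mul x ψ) = (2 : ℝ) • (-(‖x‖ ^ 2) • ψ) := by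
    rw [two_smul]
    nth_rw 1 [hexp.trans Finset.sum_comm]
    rw [hexp, ← Finset.sum_add_distrib]
    simp only [← Finset.sum_add_distrib]
    calc _ = ∑ k, ∑ j, if j = k then (x j * x k) • (-2 : ℝ) • ψ else 0 := by
          refine Finset.sum_congr rfl fun k _ => Finset.sum_congr rfl fun j _ => ?_
          rw [mul_comm (x k), ← smul_add, S.clifford_apply]
          split_ifs <;> simp
      _ = ∑ k, (x k ^ 2) • (-2 : ℝ) • ψ := by
          simp [sq]
      _ = _ := by
          rw [← Finset.sum_smul, EuclideanSpace.norm_sq_eq]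
          simp only [Real.norm_eq_abs, sq_abs]
          module
  exact smul_right_injective _ (two_ne_zero (α := ℝ)) hsym

theorem inner_mul (x : Eucl m) (φ ψ : Spinor m) :
    inner ℂ (S.mul x φ) ψ = -inner ℂ φ (S.mul x ψ) := by
  simp only [SpinRep.mul, sum_inner, inner_sum, inner_smul_left, inner_smul_right,
    Complex.conj_ofReal]
  rw [← Finset.sum_neg_distrib]
  refine Finset.sum_congr rfl fun k _ => ?_
  have h : inner ℂ (Matrix.toEuclideanLin (S.α k) φ) ψ
      = inner ℂ φ (Matrix.toEuclideanLin (S.α k).conjTranspose ψ) := by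
    rw [Matrix.toEuclideanLin_conjTranspose_eq_adjoint, LinearMap.adjoint_inner_right]
  rw [h, S.skew, map_neg, LinearMap.neg_apply, inner_neg_right, mul_neg]

/-- The spinors `γ` and `x · γ` are orthogonal for the real inner product, and
`|x · γ| = |x| |γ|`. -/
theorem norm_smul_add_smul_mul_sq (a b : ℝ) (x : Eucl m) (γ : Spinor m) :
    ‖a • γ + b • S.mul x γ‖ ^ 2 = (a ^ 2 + b ^ 2 * ‖x‖ ^ 2) * ‖γ‖ ^ 2 := by
  have h0 : RCLike.re (inner ℂ γ (S.mul x γ)) = 0 := by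
    have h1 := congrArg RCLike.re (S.inner_mul x γ γ)
    rw [map_neg, inner_re_symm] at h1
    linarith
  have h2 : ‖S.mul x γ‖ ^ 2 = ‖x‖ ^ 2 * ‖γ‖ ^ 2 := by
    rw [← inner_self_eq_norm_sq (𝕜 := ℂ), S.inner_mul, S.mul_mul_self, ← Complex.coe_smul,
      inner_smul_right, inner_self_eq_norm_sq_to_K]
    simp [← Complex.ofReal_pow, ← Complex.ofReal_mul]
  rw [← Complex.coe_smul, ← Complex.coe_smul, norm_add_sq (𝕜 := ℂ), inner_smul_left,
    inner_smul_right, norm_smul, norm_smul, mul_pow, mul_pow, h2, Complex.conj_ofReal, ← mul_assoc,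
    ← Complex.ofReal_mul]
  have h3 : RCLike.re (((a * b : ℝ) : ℂ) * inner ℂ γ (S.mul x γ)) = 0 := by
    have : RCLike.re (((a * b : ℝ) : ℂ) * inner ℂ γ (S.mul x γ))
        = (a * b) * RCLike.re (inner ℂ γ (S.mul x γ)) := by
      simp only [RCLike.re_to_complex, Complex.re_ofReal_mul]
    rw [this, h0, mul_zero]
  rw [h3]
  simp only [Complex.norm_real, Real.norm_eq_abs, sq_abs]
  ring

end SpinRep

/-! ### Fields in the logarithmic radial variable -/

/-- The spinor field `A(t) γ + B(t) x · γ` with `t = -log |x|`. -/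
noncomputable def logField {m : ℕ} (S : SpinRep m) (γ : Spinor m) (A B : ℝ → ℝ) (x : Eucl m) :
    Spinor m :=
  A (-Real.log ‖x‖) • γ + B (-Real.log ‖x‖) • S.mul x γ

/-- The derivative of `logField` at `x ≠ 0`, in terms of the values `a', b, b'` of `A'`, `B`, `B'`
at `-log |x|`. -/
noncomputable def logFieldDeriv {m : ℕ} (S : SpinRep m) (γ : Spinor m) (a' b b' : ℝ) (x : Eucl m) :
    Eucl m →L[ℝ] Spinor m :=
  (-(‖x‖ ^ 2)⁻¹ • innerSL ℝ x).smulRight (a' • γ + b' • S.mulCLM γ x) + b • S.mulCLM γ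

variable {m : ℕ} {S : SpinRep m} {γ : Spinor m}

theorem hasFDerivAt_neg_log_norm {x : Eucl m} (hx : x ≠ 0) :
    HasFDerivAt (fun x : Eucl m => -Real.log ‖x‖) (-(‖x‖ ^ 2)⁻¹ • innerSL ℝ x) x := by
  have h : HasFDerivAt (fun x : Eucl m => -(Real.log (‖x‖ ^ 2) / 2))
      (-(‖x‖ ^ 2)⁻¹ • innerSL ℝ x) x := by
    have h1 := (((hasFDerivAt_id x).norm_sq.log (by simpa using hx)).mul_const (2⁻¹ : ℝ)).neg
    refine HasFDerivAt.congr_fderiv h1 ?_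
    ext y
    simp
    ring
  refine h.congr_of_eventuallyEq (Eventually.of_forall fun y => ?_)
  simp only [Real.log_pow]
  push_cast
  ring

theorem hasFDerivAt_logField {A B : ℝ → ℝ} {a' b' : ℝ} {x : Eucl m} (hx : x ≠ 0)
    (hA : HasDerivAt A a' (-Real.log ‖x‖)) (hB : HasDerivAt B b' (-Real.log ‖x‖)) :
    HasFDerivAt (logField S γ A B) (logFieldDeriv S γ a' (B (-Real.log ‖x‖)) b' x) x := by
  have ht := hasFDerivAt_neg_log_norm hx
  have h1 := (hA.comp_hasFDerivAt x ht).smul_const γ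
  have h2 := (hB.comp_hasFDerivAt x ht).smul (S.mulCLM γ).hasFDerivAt
  refine HasFDerivAt.congr_fderiv (h1.add h2) ?_
  ext1 y
  simp only [logFieldDeriv, _root_.add_apply, _root_.smul_apply,
    ContinuousLinearMap.smulRight_apply, Function.comp_apply, smul_eq_mul]
  module

/-- The Dirac operator on `A(t) γ + B(t) x · γ`, where `t = -log |x|`, with `a' = A'(t)`, `b = B(t)`
and `b' = B'(t)`; it rests on `x · x · γ = -|x|² γ` and `α_k² = -1`. -/
theorem SpinRep.dirac_eq_of_hasFDerivAt {ψ : Eucl m → Spinor m} {a' b b' : ℝ} {x : Eucl m}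
    (h : HasFDerivAt ψ (logFieldDeriv S γ a' b b' x) x) (hx : x ≠ 0) :
    S.dirac ψ x = (b' - m * b) • γ - (a' / ‖x‖ ^ 2) • S.mul x γ := by
  rw [SpinRep.dirac, h.fderiv]
  have hterm : ∀ k, Matrix.toEuclideanLin (S.α k)
      (logFieldDeriv S γ a' b b' x (EuclideanSpace.single k 1))
      = x k • Matrix.toEuclideanLin (S.α k) (-(‖x‖ ^ 2)⁻¹ • (a' • γ + b' • S.mul x γ)) - b • γ := by
    intro k
    have h1 : logFieldDeriv S γ a' b b' x (EuclideanSpace.single k 1)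
        = x k • (-(‖x‖ ^ 2)⁻¹ • (a' • γ + b' • S.mul x γ))
          + b • Matrix.toEuclideanLin (S.α k) γ := by
      simp only [logFieldDeriv, _root_.add_apply, _root_.smul_apply,
        ContinuousLinearMap.smulRight_apply, SpinRep.mulCLM_apply, innerSL_apply_apply,
        EuclideanSpace.inner_single_right, SpinRep.mul_single]
      simp only [conj_trivial, one_mul, smul_eq_mul]
      module
    rw [h1, map_add, LinearMap.map_smul_of_tower, LinearMap.map_smul_of_tower _ b, S.sq_apply,
      smul_neg, sub_eq_add_neg]
  rw [Finset.sum_congr rfl fun k _ => hterm k, Finset.sum_sub_distrib, ← S.mul_eq_sum,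
    Finset.sum_const, Finset.card_univ, Fintype.card_fin, S.mul_smul_right, S.mul_add_right,
    S.mul_smul_right, S.mul_smul_right, S.mul_mul_self, ← Nat.cast_smul_eq_nsmul ℝ]
  have : ‖x‖ ^ 2 ≠ 0 := by simpa using hx
  have e : (-(‖x‖ ^ 2)⁻¹ * b' * -(‖x‖ ^ 2)) = b' := by field_simp
  rw [smul_add, smul_smul, smul_smul, smul_smul, e, smul_smul, div_eq_inv_mul]
  module

theorem contDiffOn_logField {A B : ℝ → ℝ} (hA : ContDiff ℝ ∞ A) (hB : ContDiff ℝ ∞ B) :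
    ContDiffOn ℝ ∞ (logField S γ A B) {0}ᶜ := by
  have ht : ContDiffOn ℝ ∞ (fun x : Eucl m => -Real.log ‖x‖) {0}ᶜ := by
    refine ContDiffOn.neg (ContDiffOn.log (contDiffOn_id.norm ℝ fun x hx => hx) fun x hx => ?_)
    simpa using hx
  exact ((hA.comp_contDiffOn ht).smul contDiffOn_const).add
    ((hB.comp_contDiffOn ht).smul (S.mulCLM γ).contDiff.contDiffOn)

/-- Convergence of `F i y` to `f x` as `i → l` and `y → x`, for every `x` in an open set, implies
uniform convergence on its compact subsets. -/
theorem tendstoUniformlyOn_of_tendsto_prod {ι X Y : Type*} [TopologicalSpace X] [UniformSpace Y]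
    {F : ι → X → Y} {f : X → Y} {l : Filter ι} {Ω K : Set X} (hΩ : IsOpen Ω)
    (hf : ContinuousOn f Ω)
    (h : ∀ x ∈ Ω, Tendsto (fun p : ι × X => F p.1 p.2) (l ×ˢ 𝓝 x) (𝓝 (f x)))
    (hKΩ : K ⊆ Ω) (hK : IsCompact K) : TendstoUniformlyOn F f l K := by
  rw [← tendstoLocallyUniformlyOn_iff_tendstoUniformlyOn_of_compact hK,
    tendstoLocallyUniformlyOn_iff_filter]
  intro x hx U hU
  have h1 : Tendsto (fun p : ι × X => f p.2) (l ×ˢ 𝓝 x) (𝓝 (f x)) :=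
    ((hf.continuousAt (hΩ.mem_nhds (hKΩ hx))).tendsto).comp tendsto_snd
  -- both entries converge to `f x`
  have h2 : ∀ᶠ p in l ×ˢ 𝓝 x, (f p.2, F p.1 p.2) ∈ U :=
    (h1.prodMk_nhds (h x (hKΩ hx))).eventually (nhds_le_uniformity (f x) hU)
  exact h2.filter_mono (prod_mono_right _ nhdsWithin_le_nhds)

theorem tendsto_logFieldDeriv {κ : Type*} {L : Filter κ} {p q r : κ → ℝ} {y : κ → Eucl m}
    {p₀ q₀ r₀ : ℝ} {x : Eucl m} (hx : x ≠ 0) (hp : Tendsto p L (𝓝 p₀)) (hq : Tendsto q L (𝓝 q₀))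
    (hr : Tendsto r L (𝓝 r₀)) (hy : Tendsto y L (𝓝 x)) :
    Tendsto (fun k => logFieldDeriv S γ (p k) (q k) (r k) (y k)) L
      (𝓝 (logFieldDeriv S γ p₀ q₀ r₀ x)) := by
  have h1 : Tendsto (fun k => -(‖y k‖ ^ 2)⁻¹ • innerSL ℝ (y k)) L
      (𝓝 (-(‖x‖ ^ 2)⁻¹ • innerSL ℝ x)) :=
    (((hy.norm.pow 2).inv₀ (by simpa using hx)).neg).smul
      (((innerSL ℝ).continuous.tendsto x).comp hy)
  have h2 : Tendsto (fun k => p k • γ + r k • S.mulCLM γ (y k)) L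
      (𝓝 (p₀ • γ + r₀ • S.mulCLM γ x)) :=
    (hp.smul_const γ).add (hr.smul (((S.mulCLM γ).continuous.tendsto x).comp hy))
  have h3 := ((isBoundedBilinearMap_smulRight (𝕜 := ℝ) (E := Eucl m)
    (F := Spinor m)).continuous.tendsto (_, _)).comp (h1.prodMk_nhds h2)
  exact h3.add (hq.smul_const _)

/-- Locally uniform convergence of the coefficients and of their derivatives gives `C¹_loc`
convergence of the fields away from the origin. -/
theorem tendstoC1Loc_logField {ι : Type*} {l : Filter ι} {A B A' B' : ι → ℝ → ℝ}
    {a b a' b' : ℝ → ℝ} (hA : ∀ᶠ i in l, ∀ t, HasDerivAt (A i) (A' i t) t)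
    (hB : ∀ᶠ i in l, ∀ t, HasDerivAt (B i) (B' i t) t)
    (ha : ∀ t, HasDerivAt a (a' t) t) (hb : ∀ t, HasDerivAt b (b' t) t)
    (ha' : Continuous a') (hb' : Continuous b')
    (hAt : ∀ t, Tendsto (fun p : ι × ℝ => A p.1 p.2) (l ×ˢ 𝓝 t) (𝓝 (a t)))
    (hBt : ∀ t, Tendsto (fun p : ι × ℝ => B p.1 p.2) (l ×ˢ 𝓝 t) (𝓝 (b t)))
    (hAt' : ∀ t, Tendsto (fun p : ι × ℝ => A' p.1 p.2) (l ×ˢ 𝓝 t) (𝓝 (a' t)))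
    (hBt' : ∀ t, Tendsto (fun p : ι × ℝ => B' p.1 p.2) (l ×ˢ 𝓝 t) (𝓝 (b' t)))
    {ψ : Eucl m → Spinor m} (hψ : ∀ x, x ≠ 0 → ψ x = logField S γ a b x) :
    TendstoC1Loc (fun i => logField S γ (A i) (B i)) l ψ {0}ᶜ := by
  have hopen : IsOpen ({0}ᶜ : Set (Eucl m)) := isOpen_compl_singleton
  have hlog : ∀ x : Eucl m, x ≠ 0 → ContinuousAt (fun x : Eucl m => -Real.log ‖x‖) x :=
    fun x hx => (hasFDerivAt_neg_log_norm hx).continuousAt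
  have hder : ∀ x : Eucl m, x ≠ 0 → HasFDerivAt ψ (logFieldDeriv S γ (a' (-Real.log ‖x‖))
      (b (-Real.log ‖x‖)) (b' (-Real.log ‖x‖)) x) x := fun x hx =>
    (hasFDerivAt_logField hx (ha _) (hb _)).congr_of_eventuallyEq (by
      filter_upwards [hopen.mem_nhds hx] with y hy using hψ y hy)
  have hpull : ∀ {G : ι → ℝ → ℝ} {g : ℝ → ℝ},
      (∀ t, Tendsto (fun p : ι × ℝ => G p.1 p.2) (l ×ˢ 𝓝 t) (𝓝 (g t))) → ∀ x : Eucl m, x ≠ 0 →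
      Tendsto (fun p : ι × Eucl m => G p.1 (-Real.log ‖p.2‖)) (l ×ˢ 𝓝 x)
        (𝓝 (g (-Real.log ‖x‖))) := fun hG x hx =>
    (hG _).comp (tendsto_fst.prodMk ((hlog x hx).tendsto.comp tendsto_snd))
  intro K hK hKc
  constructor
  · refine tendstoUniformlyOn_of_tendsto_prod hopen
      (fun x hx => (hder x hx).continuousAt.continuousWithinAt) (fun x hx => ?_) hK hKc
    rw [hψ x hx]
    exact ((hpull hAt x hx).smul_const γ).add ((hpull hBt x hx).smul
      (((S.mulCLM γ).continuous.tendsto x).comp tendsto_snd))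
  · refine tendstoUniformlyOn_of_tendsto_prod hopen (fun x hx => ?_) (fun x hx => ?_) hK hKc
    · refine ContinuousAt.continuousWithinAt ?_
      have hev : fderiv ℝ ψ =ᶠ[𝓝 x] fun x => logFieldDeriv S γ (a' (-Real.log ‖x‖))
          (b (-Real.log ‖x‖)) (b' (-Real.log ‖x‖)) x := by
        filter_upwards [hopen.mem_nhds hx] with y hy using (hder y hy).fderiv
      refine ContinuousAt.congr ?_ hev.symm
      exact tendsto_logFieldDeriv hx (ha'.continuousAt.tendsto.comp (hlog x hx))
        ((hb _).continuousAt.tendsto.comp (hlog x hx))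
        (hb'.continuousAt.tendsto.comp (hlog x hx)) tendsto_id
    · rw [(hder x hx).fderiv]
      have hlim := tendsto_logFieldDeriv (S := S) (γ := γ) hx (hpull hAt' x hx)
        (hpull hBt x hx) (hpull hBt' x hx) (tendsto_snd (f := l) (g := 𝓝 x))
      refine hlim.congr' ?_
      have e1 : ∀ᶠ p in l ×ˢ 𝓝 x, (∀ t, HasDerivAt (A p.1) (A' p.1 t) t) ∧
          ∀ t, HasDerivAt (B p.1) (B' p.1 t) t := tendsto_fst.eventually (hA.and hB)
      have e2 : ∀ᶠ p in l ×ˢ 𝓝 x, p.2 ≠ 0 := tendsto_snd.eventually (hopen.mem_nhds hx)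
      filter_upwards [e1, e2] with p hp hp0
      exact (hasFDerivAt_logField hp0 (hp.1 _) (hp.2 _)).fderiv.symm

/-! ### Delaunay-type fields -/

/-- The coefficient of `γ` in the field attached to an orbit `(u, v)`, as a function of
`t = -log |x|`. -/
noncomputable def profileA (m : ℕ) (u : ℝ → ℝ) (t : ℝ) : ℝ :=
  -u t * Real.exp (((m : ℝ) - 1) / 2 * t)

/-- The coefficient of `x · γ` in the field attached to an orbit `(u, v)`, as a function of
`t = -log |x|`. -/
noncomputable def profileB (m : ℕ) (v : ℝ → ℝ) (t : ℝ) : ℝ :=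
  v t * Real.exp ((((m : ℝ) - 1) / 2 + 1) * t)

variable {μ : ℝ} {u v : ℝ → ℝ}

theorem exp_neg_log_norm {x : Eucl m} (hx : x ≠ 0) : Real.exp (-Real.log ‖x‖) = ‖x‖⁻¹ := by
  rw [Real.exp_neg, Real.exp_log (norm_pos_iff.2 hx)]

theorem exp_mul_neg_log_norm {x : Eucl m} (hx : x ≠ 0) (a : ℝ) :
    Real.exp (a * (-Real.log ‖x‖)) = ‖x‖ ^ (-a) := by
  rw [Real.rpow_def_of_pos (norm_pos_iff.2 hx)]
  congr 1
  ring

theorem exp_add_one_mul (a t : ℝ) : Real.exp ((a + 1) * t) = Real.exp (a * t) * Real.exp t := by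
  rw [← Real.exp_add]
  congr 1
  ring

theorem ansatz_emdenFowler_eq_logField (S : SpinRep m) (γ : Spinor m) (u v : ℝ → ℝ) {x : Eucl m}
    (hx : x ≠ 0) : ansatz S γ (fun r => -emdenFowler m u r) (emdenFowler m v) x
      = logField S γ (profileA m u) (profileB m v) x := by
  rw [ansatz, logField, profileA, profileB, emdenFowler, emdenFowler, exp_add_one_mul,
    exp_neg_log_norm hx]
  match_scalars <;> ring

theorem mem_delaunayFamily_iff {ψ : Eucl m → Spinor m} : ψ ∈ delaunayFamily S γ μ ↔
    ∃ u v, IsPeriodicOrbit m μ u v ∧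
      ∀ x, x ≠ 0 → ψ x = logField S γ (profileA m u) (profileB m v) x := by
  refine exists_congr fun u => exists_congr fun v => and_congr_right fun _ => ?_
  exact forall₂_congr fun x hx => by rw [ansatz_emdenFowler_eq_logField _ _ _ _ hx]

namespace IsOrbit

theorem hasDerivAt_profileA (h : IsOrbit m μ u v) (t : ℝ) : HasDerivAt (profileA m u)
    (-((u t ^ 2 + v t ^ 2) ^ (1 / ((m : ℝ) - 1)) * v t) * Real.exp (((m : ℝ) - 1) / 2 * t)) t := by
  have he : HasDerivAt (fun t => Real.exp (((m : ℝ) - 1) / 2 * t))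
      (Real.exp (((m : ℝ) - 1) / 2 * t) * (((m : ℝ) - 1) / 2)) t := by
    simpa using ((hasDerivAt_id t).const_mul (((m : ℝ) - 1) / 2)).exp
  exact ((h.hasDerivAt_u t).neg.mul he).congr_deriv (by simp only [Pi.neg_apply]; ring)

theorem hasDerivAt_profileB (h : IsOrbit m μ u v) (t : ℝ) : HasDerivAt (profileB m v)
    ((m * v t - (u t ^ 2 + v t ^ 2) ^ (1 / ((m : ℝ) - 1)) * u t)
      * Real.exp ((((m : ℝ) - 1) / 2 + 1) * t)) t := by
  have he : HasDerivAt (fun t => Real.exp ((((m : ℝ) - 1) / 2 + 1) * t))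
      (Real.exp ((((m : ℝ) - 1) / 2 + 1) * t) * (((m : ℝ) - 1) / 2 + 1)) t := by
    simpa using ((hasDerivAt_id t).const_mul (((m : ℝ) - 1) / 2 + 1)).exp
  exact ((h.hasDerivAt_v t).mul he).congr_deriv (by ring)

/-- Nontrivial orbits avoid the origin, where the vector field fails to be smooth. -/
theorem contDiff (hm : 2 ≤ m) (h : IsOrbit m μ u v) (hμ : μ ≠ 0) :
    ContDiff ℝ ∞ u ∧ ContDiff ℝ ∞ v := by
  have hn : ∀ n : ℕ, ContDiff ℝ n u ∧ ContDiff ℝ n v := by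
    intro n
    induction n with
    | zero => exact ⟨contDiff_zero.2 h.continuous_u, contDiff_zero.2 h.continuous_v⟩
    | succ n ih =>
      obtain ⟨hu, hv⟩ := ih
      have hp : ContDiff ℝ n fun t => (u t ^ 2 + v t ^ 2) ^ (1 / ((m : ℝ) - 1)) :=
        ((hu.pow 2).add (hv.pow 2)).rpow_const_of_ne fun t => (h.sq_add_sq_pos hm hμ t).ne'
      have hu' : deriv u = _ := funext fun t => (h.hasDerivAt_u t).deriv
      have hv' : deriv v = _ := funext fun t => (h.hasDerivAt_v t).deriv
      push_cast
      rw [contDiff_succ_iff_deriv, contDiff_succ_iff_deriv, hu', hv']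
      exact ⟨⟨fun t => (h.hasDerivAt_u t).differentiableAt, by simp,
        (contDiff_const.mul hu).add (hp.mul hv)⟩,
        ⟨fun t => (h.hasDerivAt_v t).differentiableAt, by simp,
        (contDiff_const.mul hv).sub (hp.mul hu)⟩⟩
  exact ⟨contDiff_infty.2 fun n => (hn n).1, contDiff_infty.2 fun n => (hn n).2⟩

end IsOrbit

theorem norm_logField_profile (hγ : ‖γ‖ = 1) (u v : ℝ → ℝ) {x : Eucl m} (hx : x ≠ 0) :
    ‖logField S γ (profileA m u) (profileB m v) x‖ = ‖x‖ ^ (-(((m : ℝ) - 1) / 2)) *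
      Real.sqrt (u (-Real.log ‖x‖) ^ 2 + v (-Real.log ‖x‖) ^ 2) := by
  have hx' : ‖x‖ ≠ 0 := norm_ne_zero_iff.2 hx
  rw [← sq_eq_sq₀ (norm_nonneg _) (by positivity), logField, S.norm_smul_add_smul_mul_sq, hγ,
    mul_pow, Real.sq_sqrt (by positivity), profileA, profileB, exp_add_one_mul,
    exp_neg_log_norm hx, exp_mul_neg_log_norm hx]
  field_simp

theorem isSolution_of_isOrbit (hm : 2 ≤ m) (hγ : ‖γ‖ = 1) (h : IsOrbit m μ u v) (hμ : μ ≠ 0)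
    {ψ : Eucl m → Spinor m}
    (hψ : ∀ x, x ≠ 0 → ψ x = logField S γ (profileA m u) (profileB m v) x) : IsSolution S ψ := by
  have hm' : (2 : ℝ) ≤ m := by exact_mod_cast hm
  obtain ⟨hu, hv⟩ := h.contDiff hm hμ
  constructor
  · have hA : ContDiff ℝ ∞ (profileA m u) := by
      unfold profileA
      fun_prop
    have hB : ContDiff ℝ ∞ (profileB m v) := by
      unfold profileB
      fun_prop
    exact (contDiffOn_logField hA hB).congr hψ
  · intro x hx
    have hder := (hasFDerivAt_logField (S := S) (γ := γ) hx (h.hasDerivAt_profileA _)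
      (h.hasDerivAt_profileB _)).congr_of_eventuallyEq (f₁ := ψ) (by
        filter_upwards [isOpen_compl_singleton.mem_nhds hx] with y hy using hψ y hy)
    have hx' : 0 < ‖x‖ := norm_pos_iff.2 hx
    rw [SpinRep.dirac_eq_of_hasFDerivAt hder hx, hψ x hx, norm_logField_profile hγ u v hx,
      logField]
    set t := -Real.log ‖x‖ with ht
    set ρ := u t ^ 2 + v t ^ 2 with hρ
    have hρ0 : 0 ≤ ρ := by positivity
    have hpow : (‖x‖ ^ (-(((m : ℝ) - 1) / 2)) * Real.sqrt ρ) ^ (2 / ((m : ℝ) - 1))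
        = ‖x‖⁻¹ * ρ ^ (1 / ((m : ℝ) - 1)) := by
      have hm1 : (m : ℝ) - 1 ≠ 0 := by linarith
      rw [Real.mul_rpow (by positivity) (Real.sqrt_nonneg _), ← Real.rpow_mul hx'.le,
        Real.sqrt_eq_rpow, ← Real.rpow_mul hρ0, ← Real.rpow_neg_one]
      congr 2 <;> field_simp
    rw [hpow, profileA, profileB, exp_add_one_mul, ht, exp_neg_log_norm hx, ← ht]
    match_scalars
    · field_simp
      ring
    · field_simp

theorem mem_ansatzSpace_of_isOrbit (hm : 2 ≤ m) (hγ : ‖γ‖ = 1) (h : IsOrbit m μ u v) (hμ : μ ≠ 0)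
    {ψ : Eucl m → Spinor m}
    (hψ : ∀ x, x ≠ 0 → ψ x = logField S γ (profileA m u) (profileB m v) x) :
    ψ ∈ ansatzSpace S := by
  obtain ⟨hu, hv⟩ := h.contDiff hm hμ
  have hsm : ∀ {w : ℝ → ℝ}, ContDiff ℝ ∞ w → ContDiffOn ℝ ∞ (emdenFowler m w) (Ioi 0) := by
    intro w hw
    have hlog : ContDiffOn ℝ ∞ (fun r => -Real.log r) (Ioi 0) :=
      (contDiffOn_id.log fun r hr => (ne_of_gt hr)).neg
    exact (hw.comp_contDiffOn hlog).mul (contDiffOn_const.mul hlog).exp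
  exact ⟨_, _, (hsm hu).neg, hsm hv, γ, hγ, fun x hx =>
    (hψ x hx).trans (ansatz_emdenFowler_eq_logField S γ u v hx).symm⟩

/-- The growth of the fields: `|ψ(x)| |x|^((m-1)/2)` lies between positive constants. -/
theorem exists_norm_bounds (hm : 2 ≤ m) (hγ : ‖γ‖ = 1) (h : IsPeriodicOrbit m μ u v) (hμ : μ ≠ 0)
    {ψ : Eucl m → Spinor m}
    (hψ : ∀ x, x ≠ 0 → ψ x = logField S γ (profileA m u) (profileB m v) x) :
    ∃ a > 0, ∃ b, ∀ x, x ≠ 0 → ‖x‖ ^ (-(((m : ℝ) - 1) / 2)) * a ≤ ‖ψ x‖ ∧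
      ‖ψ x‖ ≤ b * ‖x‖ ^ (-(((m : ℝ) - 1) / 2)) := by
  have ho := h.isOrbit
  obtain ⟨T, hT, hu, hv⟩ := h.periodic
  obtain ⟨t₀, hmin⟩ := exists_forall_le_of_periodic (f := fun t => -(u t ^ 2 + v t ^ 2))
    ((ho.continuous_u.pow 2).add (ho.continuous_v.pow 2)).neg hT
    (fun t => by simp only [hu t, hv t])
  refine ⟨Real.sqrt (u t₀ ^ 2 + v t₀ ^ 2), Real.sqrt_pos.2 (ho.sq_add_sq_pos hm hμ t₀),
    Real.sqrt (max ((m : ℝ) ^ (m - 1)) (4 * |μ|)), fun x hx => ?_⟩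
  rw [hψ x hx, norm_logField_profile hγ u v hx]
  constructor
  · gcongr ?_ * Real.sqrt ?_
    linarith [hmin (-Real.log ‖x‖)]
  · rw [mul_comm]
    gcongr
    exact sq_add_sq_le_of_hamiltonian hm (ho.energy _)

theorem asymptotics_of_norm_bounds (hm : 2 ≤ m) {ψ : Eucl m → Spinor m} {a b : ℝ} (ha : 0 < a)
    (h : ∀ x, x ≠ 0 → ‖x‖ ^ (-(((m : ℝ) - 1) / 2)) * a ≤ ‖ψ x‖ ∧
      ‖ψ x‖ ≤ b * ‖x‖ ^ (-(((m : ℝ) - 1) / 2))) :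
    Tendsto (fun x => ‖ψ x‖) (𝓝[≠] 0) atTop ∧ (∀ x, x ≠ 0 → ψ x ≠ 0) ∧
      (fun x => ‖ψ x‖) =O[Bornology.cobounded (Eucl m)]
        (fun x => ‖x‖ ^ (-(((m : ℝ) - 1) / 2))) ∧
      (fun x => ‖ψ x‖) =O[𝓝[≠] 0] (fun x => ‖x‖ ^ (-(((m : ℝ) - 1) / 2))) := by
  have hm' : (2 : ℝ) ≤ m := by exact_mod_cast hm
  have hO : ∀ l : Filter (Eucl m), (∀ᶠ x in l, x ≠ 0) →
      (fun x => ‖ψ x‖) =O[l] (fun x => ‖x‖ ^ (-(((m : ℝ) - 1) / 2))) := by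
    intro l hl
    refine Asymptotics.IsBigO.of_bound b ?_
    filter_upwards [hl] with x hx
    rw [norm_norm, Real.norm_of_nonneg (by positivity)]
    exact (h x hx).2
  refine ⟨?_, fun x hx h0 => ?_, hO _ ?_, hO _ self_mem_nhdsWithin⟩
  · have h1 : Tendsto (fun x : Eucl m => ‖x‖ ^ (-(((m : ℝ) - 1) / 2))) (𝓝[≠] 0) atTop :=
      (tendsto_rpow_neg_nhdsGT_zero (by linarith)).comp tendsto_norm_nhdsNE_zero
    refine tendsto_atTop_mono' _ ?_ (h1.atTop_mul_const ha)
    filter_upwards [self_mem_nhdsWithin] with x hx using (h x hx).1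
  · have h1 := (h x hx).1
    rw [h0, norm_zero] at h1
    have : 0 < ‖x‖ := norm_pos_iff.2 hx
    have : 0 < ‖x‖ ^ (-(((m : ℝ) - 1) / 2)) * a := by positivity
    linarith
  · filter_upwards [Bornology.isBounded_def.1 (Bornology.isBounded_singleton (x := (0 : Eucl m)))]
      with x hx using hx

/-- The energy can be read off the field: `|x|^(m-1) |ψ(x)|²` determines `u² + v²`, whose maximum
determines the energy. -/
theorem energy_unique (hm : 2 ≤ m) {γ' : Spinor m} (hγ : ‖γ‖ = 1) (hγ' : ‖γ'‖ = 1) {μ' : ℝ}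
    (hμ : μ ≠ 0) (hμ' : μ' ≠ 0) {ψ : Eucl m → Spinor m} (h : ψ ∈ delaunayFamily S γ μ)
    (h' : ψ ∈ delaunayFamily S γ' μ') : μ = μ' := by
  have hm' : (2 : ℝ) ≤ m := by exact_mod_cast hm
  obtain ⟨u, v, ho, hψ⟩ := mem_delaunayFamily_iff.1 h
  obtain ⟨u', v', ho', hψ'⟩ := mem_delaunayFamily_iff.1 h'
  have hρ : ∀ t, u t ^ 2 + v t ^ 2 = u' t ^ 2 + v' t ^ 2 := by
    intro t
    have hnorm : ‖EuclideanSpace.single (⟨0, by omega⟩ : Fin m) (Real.exp (-t))‖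
        = Real.exp (-t) := by
      rw [PiLp.norm_single, Real.norm_of_nonneg (Real.exp_pos _).le]
    set x : Eucl m := EuclideanSpace.single ⟨0, by omega⟩ (Real.exp (-t))
    have hx : x ≠ 0 := norm_pos_iff.1 (hnorm ▸ Real.exp_pos _)
    have ht : -Real.log ‖x‖ = t := by rw [hnorm, Real.log_exp, neg_neg]
    have e := norm_logField_profile (S := S) hγ u v hx
    rw [← hψ x hx, hψ' x hx, norm_logField_profile hγ' u' v' hx, ht] at e
    have hpos : 0 < ‖x‖ := norm_pos_iff.2 hx
    have e' := mul_left_cancel₀ (by positivity) e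
    exact ((Real.sqrt_inj (by positivity) (by positivity)).1 e').symm
  obtain ⟨t₀, y, hy, huv, hu, hE, hmax⟩ := IsOrbit.exists_max hm ho hμ
  obtain ⟨t₁, y', hy', huv', hu', hE', hmax'⟩ := IsOrbit.exists_max hm ho' hμ'
  have e1 : u t₀ ^ 2 + v t₀ ^ 2 = y ^ (m - 1) := by rw [← huv, hu]; ring
  have e2 : u' t₁ ^ 2 + v' t₁ ^ 2 = y' ^ (m - 1) := by rw [← huv', hu']; ring
  have e3 : y ^ (m - 1) = y' ^ (m - 1) := by
    rw [← e1, ← e2]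
    exact le_antisymm (hρ t₀ ▸ hmax' t₀) (hρ t₁ ▸ hmax t₁)
  have : y = y' := (pow_left_inj₀ (by linarith) (by linarith) (by omega)).1 e3
  rw [← hE, ← hE', this]

theorem exists_sign_dilation (hm : 2 ≤ m) (hμ : μ ≠ 0) {ψ ψ' : Eucl m → Spinor m}
    (h : ψ ∈ delaunayFamily S γ μ) (h' : ψ' ∈ delaunayFamily S γ μ) :
    ∃ σ : ℝ, (σ = 1 ∨ σ = -1) ∧ ∃ ρ : ℝ, 0 < ρ ∧
      ∀ x, x ≠ 0 → ψ' x = (σ * ρ ^ (((m : ℝ) - 1) / 2)) • ψ (ρ • x) := by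
  obtain ⟨u, v, ho, hψ⟩ := mem_delaunayFamily_iff.1 h
  obtain ⟨u', v', ho', hψ'⟩ := mem_delaunayFamily_iff.1 h'
  obtain ⟨σ, hσ, τ, hτ⟩ := ho.eq_up_to_sign_and_translation hm hμ ho'
  refine ⟨σ, hσ, Real.exp (-τ), Real.exp_pos _, fun x hx => ?_⟩
  have hx2 : Real.exp (-τ) • x ≠ 0 := smul_ne_zero (Real.exp_ne_zero _) hx
  have ht : -Real.log ‖Real.exp (-τ) • x‖ = -Real.log ‖x‖ + τ := by
    rw [norm_smul, Real.norm_of_nonneg (Real.exp_pos _).le, Real.log_mul (Real.exp_ne_zero _)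
      (norm_ne_zero_iff.2 hx), Real.log_exp]
    ring
  rw [hψ _ hx2, hψ' x hx, logField, logField, ht, S.mul_smul_left]
  set t := -Real.log ‖x‖
  rw [profileA, profileA, profileB, profileB, (hτ t).1, (hτ t).2, ← Real.exp_mul]
  have e1 : Real.exp (((m : ℝ) - 1) / 2 * t)
      = Real.exp (-τ * (((m : ℝ) - 1) / 2)) * Real.exp (((m : ℝ) - 1) / 2 * (t + τ)) := by
    rw [← Real.exp_add]
    congr 1
    ring
  have e2 : Real.exp ((((m : ℝ) - 1) / 2 + 1) * t)
      = Real.exp (-τ * (((m : ℝ) - 1) / 2)) *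
        (Real.exp ((((m : ℝ) - 1) / 2 + 1) * (t + τ)) * Real.exp (-τ)) := by
    rw [← Real.exp_add, ← Real.exp_add]
    congr 1
    ring
  rw [e1, e2]
  module

/-! ### The homoclinic orbit and the bubble -/

/-- The first component `-N cosh(t)^(-m/2) e^(t/2)` of the orbit homoclinic to the origin. -/
noncomputable def homoclinicU (m : ℕ) (N t : ℝ) : ℝ :=
  -(N * Real.cosh t ^ (-((m : ℝ) / 2)) * Real.exp (t / 2))

/-- The second component `-N cosh(t)^(-m/2) e^(-t/2)` of the orbit homoclinic to the origin. -/
noncomputable def homoclinicV (m : ℕ) (N t : ℝ) : ℝ :=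
  -(N * Real.cosh t ^ (-((m : ℝ) / 2)) * Real.exp (-(t / 2)))

/-- The value of `N` makes the orbit start on the diagonal at `y = m/2`, the positive zero of
`diagonalEnergy`. -/
theorem homoclinic_isOrbit (hm : 2 ≤ m) {N : ℝ} (hN : N ^ 2 = ((m : ℝ) / 2) ^ (m - 1) / 2) :
    IsOrbit m 0 (homoclinicU m N) (homoclinicV m N) := by
  have hm' : (2 : ℝ) ≤ m := by exact_mod_cast hm
  have hexp : ∀ t, Real.exp (t / 2) ^ 2 = Real.exp t := fun t => by
    rw [← Real.exp_nat_mul]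
    congr 1
    push_cast
    ring
  have hexp' : ∀ t, Real.exp (-(t / 2)) ^ 2 = Real.exp (-t) := fun t => by
    rw [← hexp (-t)]
    congr 2
    ring
  have hmul : ∀ t, Real.exp (t / 2) * Real.exp (-(t / 2)) = 1 := fun t => by
    rw [← Real.exp_add, add_neg_cancel, Real.exp_zero]
  have hW2 : ∀ t, (Real.cosh t ^ (-((m : ℝ) / 2))) ^ 2 = (Real.cosh t ^ m)⁻¹ := fun t => by
    rw [← Real.rpow_natCast, ← Real.rpow_mul (Real.cosh_pos t).le, ← Real.rpow_natCast,
      ← Real.rpow_neg (Real.cosh_pos t).le]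
    congr 1
    push_cast
    ring
  have hρ : ∀ t, homoclinicU m N t ^ 2 + homoclinicV m N t ^ 2
      = ((m : ℝ) / 2 / Real.cosh t) ^ (m - 1) := fun t => by
    have hc := (Real.cosh_pos t).ne'
    have h1 : Real.cosh t ^ m = Real.cosh t ^ (m - 1) * Real.cosh t := by
      rw [← pow_succ]
      congr 1
      omega
    calc _ = N ^ 2 * (Real.cosh t ^ (-((m : ℝ) / 2))) ^ 2
          * (Real.exp (t / 2) ^ 2 + Real.exp (-(t / 2)) ^ 2) := by
          rw [homoclinicU, homoclinicV]
          ring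
      _ = ((m : ℝ) / 2) ^ (m - 1) / 2 * (Real.cosh t ^ m)⁻¹ * (2 * Real.cosh t) := by
          rw [hN, hW2, hexp, hexp', Real.cosh_eq t]
          ring
      _ = _ := by
          rw [h1, div_pow ((m : ℝ) / 2) (Real.cosh t)]
          field_simp
  have hρq : ∀ t, (homoclinicU m N t ^ 2 + homoclinicV m N t ^ 2) ^ (1 / ((m : ℝ) - 1))
      = (m : ℝ) / 2 / Real.cosh t := fun t => by
    rw [hρ, pow_pred_rpow hm (div_nonneg (by positivity) (Real.cosh_pos t).le)]
  have hW : ∀ t, HasDerivAt (fun t => N * Real.cosh t ^ (-((m : ℝ) / 2)))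
      (N * (-((m : ℝ) / 2) * (Real.cosh t ^ (-((m : ℝ) / 2)) * (Real.sinh t / Real.cosh t)))) t := by
    intro t
    have h := (((Real.hasDerivAt_cosh t).rpow_const (p := -((m : ℝ) / 2))
      (Or.inl (Real.cosh_pos t).ne')).const_mul N)
    refine h.congr_deriv ?_
    rw [Real.rpow_sub_one (Real.cosh_pos t).ne']
    ring
  have hsinh : ∀ t, Real.sinh t = Real.cosh t - Real.exp (-t) := fun t => by
    rw [← Real.cosh_sub_sinh]
    ring
  have hsinh' : ∀ t, Real.sinh t = Real.exp t - Real.cosh t := fun t => by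
    rw [← Real.cosh_add_sinh]
    ring
  refine ⟨fun t => ?_, fun t => ?_, fun t => ?_⟩
  · have he : HasDerivAt (fun t => Real.exp (t / 2)) (Real.exp (t / 2) * (1 / 2)) t :=
      ((hasDerivAt_id t).div_const 2).exp
    refine HasDerivAt.congr_deriv ((hW t).mul he).neg ?_
    have hc := (Real.cosh_pos t).ne'
    have e1 : Real.exp (-(t / 2)) = Real.exp (t / 2) * Real.exp (-t) := by
      rw [← Real.exp_add]
      congr 1
      ring
    rw [hρq, homoclinicU, homoclinicV, hsinh, e1]
    field_simp
    ring
  · have he : HasDerivAt (fun t => Real.exp (-(t / 2))) (Real.exp (-(t / 2)) * (-(1 / 2))) t :=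
      ((hasDerivAt_id t).div_const 2).neg.exp
    refine HasDerivAt.congr_deriv ((hW t).mul he).neg ?_
    have hc := (Real.cosh_pos t).ne'
    have e1 : Real.exp (t / 2) = Real.exp (-(t / 2)) * Real.exp t := by
      rw [← Real.exp_add]
      congr 1
      ring
    rw [hρq, homoclinicU, homoclinicV, hsinh', e1]
    field_simp
    ring
  · rw [hamiltonian_eq hm, hρq]
    have e1 : homoclinicU m N t * homoclinicV m N t
        = N ^ 2 * (Real.cosh t ^ (-((m : ℝ) / 2))) ^ 2 * (Real.exp (t / 2) * Real.exp (-(t / 2))) := by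
      rw [homoclinicU, homoclinicV]
      ring
    have e2 : homoclinicU m N t ^ 2 + homoclinicV m N t ^ 2
        = N ^ 2 * (Real.cosh t ^ (-((m : ℝ) / 2))) ^ 2 * (2 * Real.cosh t) := by
      rw [Real.cosh_eq t]
      calc _ = N ^ 2 * (Real.cosh t ^ (-((m : ℝ) / 2))) ^ 2
            * (Real.exp (t / 2) ^ 2 + Real.exp (-(t / 2)) ^ 2) := by
            rw [homoclinicU, homoclinicV]
            ring
        _ = _ := by
            rw [hexp, hexp', Real.cosh_eq t]
            ring
    rw [e1, e2, hmul]
    have hc := (Real.cosh_pos t).ne'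
    field_simp
    ring

/-- The bubble of scale `l` is the field of the homoclinic orbit, translated by `log l`. -/
theorem bubble_eq_logField {l : ℝ} (hl : 0 < l) {γ₀ : Spinor m} (hγ₀ : γ₀ ≠ 0) {x : Eucl m}
    (hx : x ≠ 0) : bubble S l γ₀ x = logField S (‖γ₀‖⁻¹ • γ₀)
      (profileA m fun t => homoclinicU m ‖γ₀‖ (t + Real.log l))
      (profileB m fun t => homoclinicV m ‖γ₀‖ (t + Real.log l)) x := by
  have hr : 0 < ‖x‖ := norm_pos_iff.2 hx
  have hN : ‖γ₀‖ ≠ 0 := norm_ne_zero_iff.2 hγ₀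
  set t := -Real.log ‖x‖ with ht
  set k := Real.log l with hk
  have hl' : l = Real.exp k := (Real.exp_log hl).symm
  have hr' : ‖x‖ = Real.exp (-t) := by rw [ht, neg_neg, Real.exp_log hr]
  have hcosh : 2 * l / (l ^ 2 + ‖x‖ ^ 2) = Real.exp t * (Real.cosh (t + k))⁻¹ := by
    have h1 : Real.exp (t + k) = Real.exp t * Real.exp k := Real.exp_add _ _
    rw [hl', hr', Real.cosh_eq, Real.exp_neg (t + k), h1, Real.exp_neg]
    have := Real.exp_ne_zero t
    have := Real.exp_ne_zero k
    field_simp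
  have hpow : (2 * l / (l ^ 2 + ‖x‖ ^ 2)) ^ ((m : ℝ) / 2)
      = Real.exp (t * (m / 2)) * Real.cosh (t + k) ^ (-((m : ℝ) / 2)) := by
    have hc := Real.cosh_pos (t + k)
    rw [hcosh, Real.mul_rpow (Real.exp_pos _).le (by positivity), Real.inv_rpow hc.le,
      Real.rpow_neg hc.le, ← Real.exp_mul]
  have hsqrt : Real.sqrt l = Real.exp (k / 2) := by rw [hl', Real.exp_half]
  have e1 : Real.exp ((t + k) / 2) * Real.exp (((m : ℝ) - 1) / 2 * t)
      = Real.exp (k / 2) * Real.exp (t * (m / 2)) := by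
    rw [← Real.exp_add, ← Real.exp_add]
    congr 1
    ring
  have e2 : Real.exp (-((t + k) / 2)) * Real.exp ((((m : ℝ) - 1) / 2 + 1) * t)
      = Real.exp (k / 2) * Real.exp (t * (m / 2)) * l⁻¹ := by
    rw [hl', ← Real.exp_neg, ← Real.exp_add, ← Real.exp_add, ← Real.exp_add]
    congr 1
    ring
  rw [bubble, logField, profileA, profileB, ← ht, hpow, hsqrt, S.mul_smul_left, S.mul_smul_right,
    homoclinicU, homoclinicV]
  have f1 : -(-(‖γ₀‖ * Real.cosh (t + k) ^ (-((m : ℝ) / 2)) * Real.exp ((t + k) / 2)))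
      * Real.exp (((m : ℝ) - 1) / 2 * t) = ‖γ₀‖ * (Real.exp (k / 2) * (Real.exp (t * (m / 2))
        * Real.cosh (t + k) ^ (-((m : ℝ) / 2)))) := by
    linear_combination (‖γ₀‖ * Real.cosh (t + k) ^ (-((m : ℝ) / 2))) * e1
  have f2 : -(‖γ₀‖ * Real.cosh (t + k) ^ (-((m : ℝ) / 2)) * Real.exp (-((t + k) / 2)))
      * Real.exp ((((m : ℝ) - 1) / 2 + 1) * t) = -(‖γ₀‖ * (Real.exp (k / 2) *
        (Real.exp (t * (m / 2)) * Real.cosh (t + k) ^ (-((m : ℝ) / 2)))) * l⁻¹) := by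
    linear_combination -(‖γ₀‖ * Real.cosh (t + k) ^ (-((m : ℝ) / 2))) * e2
  rw [f1, f2]
  match_scalars <;> field_simp

/-! ### Convergence of the orbits to the homoclinic -/

/-- Continuous dependence: if the positions at time `0` converge, the orbits converge locally
uniformly, expressed as convergence along `l ×ˢ 𝓝 t`. -/
theorem IsOrbit.tendsto_of_tendsto_zero (hm : 2 ≤ m) {ι : Type*} {l : Filter ι} {μ : ι → ℝ}
    {U V : ι → ℝ → ℝ} {R μ₀ : ℝ} {u v : ℝ → ℝ} (h : ∀ᶠ i in l, IsOrbit m (μ i) (U i) (V i))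
    (hμ : ∀ᶠ i in l, |μ i| ≤ R) (h₀ : IsOrbit m μ₀ u v) (hμ₀ : |μ₀| ≤ R)
    (hU : Tendsto (fun i => U i 0) l (𝓝 (u 0))) (hV : Tendsto (fun i => V i 0) l (𝓝 (v 0)))
    (t : ℝ) : Tendsto (fun p : ι × ℝ => U p.1 p.2) (l ×ˢ 𝓝 t) (𝓝 (u t)) ∧
      Tendsto (fun p : ι × ℝ => V p.1 p.2) (l ×ˢ 𝓝 t) (𝓝 (v t)) := by
  obtain ⟨K, hK⟩ := IsOrbit.dist_le hm (R := R)
  have hmk : ∀ a b : ℝ, (⟨a, b⟩ : ℂ) = (a : ℂ) + (b : ℂ) * Complex.I := Complex.mk_eq_add_mul_I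
  have hz0 : Tendsto (fun i => (⟨U i 0, V i 0⟩ : ℂ)) l (𝓝 ⟨u 0, v 0⟩) := by
    simp only [hmk]
    exact ((Complex.continuous_ofReal.tendsto _).comp hU).add
      (((Complex.continuous_ofReal.tendsto _).comp hV).mul_const _)
  have hz : Tendsto (fun p : ι × ℝ => (⟨U p.1 p.2, V p.1 p.2⟩ : ℂ)) (l ×ˢ 𝓝 t)
      (𝓝 ⟨u t, v t⟩) := by
    have h1 : Tendsto (fun p : ι × ℝ => (⟨u p.2, v p.2⟩ : ℂ)) (l ×ˢ 𝓝 t) (𝓝 ⟨u t, v t⟩) :=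
      (h₀.hasDerivAt_complex t).continuousAt.tendsto.comp tendsto_snd
    refine h1.congr_dist (squeeze_zero' (Eventually.of_forall fun _ => dist_nonneg)
      (g := fun p : ι × ℝ => dist (⟨u 0, v 0⟩ : ℂ) ⟨U p.1 0, V p.1 0⟩ * Real.exp (K * |p.2|))
      ?_ ?_)
    · filter_upwards [tendsto_fst.eventually (h.and hμ)] with p hp
      exact hK h₀ hp.1 hμ₀ hp.2 p.2
    · have h2 : Tendsto (fun p : ι × ℝ => dist (⟨u 0, v 0⟩ : ℂ) ⟨U p.1 0, V p.1 0⟩)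
          (l ×ˢ 𝓝 t) (𝓝 0) := by
        have := (tendsto_const_nhds (x := (⟨u 0, v 0⟩ : ℂ))).dist (hz0.comp
          (tendsto_fst (f := l) (g := 𝓝 t)))
        rwa [dist_self] at this
      have h3 : Tendsto (fun p : ι × ℝ => Real.exp (K * |p.2|)) (l ×ˢ 𝓝 t)
          (𝓝 (Real.exp (K * |t|))) := by
        have hc : Continuous fun s : ℝ => Real.exp (K * |s|) := by fun_prop
        exact (hc.tendsto t).comp tendsto_snd
      have := h2.mul h3
      rwa [zero_mul] at this
  exact ⟨(Complex.continuous_re.tendsto _).comp hz, (Complex.continuous_im.tendsto _).comp hz⟩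

theorem eventually_mem_parameterSet (hm : 2 ≤ m) : ∀ᶠ μ in 𝓝[<] (0 : ℝ), μ ∈ parameterSet m := by
  have hm' : (2 : ℝ) ≤ m := by exact_mod_cast hm
  have hneg : -(((m : ℝ) - 1) ^ m / (2 ^ (m + 1) * m)) < 0 := by
    have : (0 : ℝ) < (m : ℝ) - 1 := by linarith
    have : 0 < ((m : ℝ) - 1) ^ m / (2 ^ (m + 1) * m) := by positivity
    linarith
  filter_upwards [self_mem_nhdsWithin, nhdsWithin_le_nhds (lt_mem_nhds hneg)] with μ h1 h2
  exact ⟨le_of_lt h2, ne_of_lt h1⟩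

theorem diagonalEnergy_half {m : ℕ} (hm : 2 ≤ m) : diagonalEnergy m ((m : ℝ) / 2) = 0 := by
  have hm0 : (m : ℝ) ≠ 0 := by positivity
  have h1 : ((m : ℝ) / 2) ^ m = ((m : ℝ) / 2) ^ (m - 1) * ((m : ℝ) / 2) := by
    rw [← pow_succ]
    congr 1
    omega
  rw [diagonalEnergy, h1]
  field_simp
  ring

/-- The starting points on the diagonal depend continuously on the energy at `0`. -/
theorem tendsto_diagonal (hm : 2 ≤ m) {y : ℝ → ℝ}
    (hy : ∀ μ ∈ parameterSet m, ((m : ℝ) - 1) / 2 ≤ y μ ∧ diagonalEnergy m (y μ) = μ) :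
    Tendsto y (𝓝[<] 0) (𝓝 ((m : ℝ) / 2)) := by
  have hmono := diagonalEnergy_strictMonoOn hm
  have hhalf : (m : ℝ) / 2 ∈ Ici (((m : ℝ) - 1) / 2) := by
    rw [mem_Ici]
    linarith
  refine tendsto_order.2 ⟨fun a ha => ?_, fun a ha => ?_⟩
  · have ha' : max a (((m : ℝ) - 1) / 2) < m / 2 := max_lt ha (by linarith)
    have hE : diagonalEnergy m (max a (((m : ℝ) - 1) / 2)) < 0 := by
      rw [← diagonalEnergy_half hm]
      exact hmono (mem_Ici.2 (le_max_right _ _)) hhalf ha'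
    filter_upwards [eventually_mem_parameterSet hm, nhdsWithin_le_nhds (lt_mem_nhds hE)]
      with μ hμ hlt
    obtain ⟨h1, h2⟩ := hy μ hμ
    rw [← h2] at hlt
    exact (le_max_left _ _).trans_lt ((hmono.lt_iff_lt (mem_Ici.2 (le_max_right _ _)) h1).1 hlt)
  · filter_upwards [eventually_mem_parameterSet hm, self_mem_nhdsWithin] with μ hμ hlt
    obtain ⟨h1, h2⟩ := hy μ hμ
    rw [mem_Iio, ← diagonalEnergy_half hm, ← h2] at hlt
    exact ((hmono.lt_iff_lt h1 hhalf).1 hlt).trans ha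

/-- The fields are those of the orbits that meet the negative half of the diagonal at time `-log l`,
as does the orbit of the bubble. -/
theorem exists_tendsto_bubble (hm : 2 ≤ m) (S : SpinRep m) {γ₀ : Spinor m}
    (hγ₀ : ‖γ₀‖ = 1 / Real.sqrt 2 * ((m : ℝ) / 2) ^ (((m : ℝ) - 1) / 2)) {l : ℝ} (hl : 0 < l) :
    ∃ Ψ : ℝ → Eucl m → Spinor m,
      (∀ μ ∈ parameterSet m, Ψ μ ∈ delaunayFamily S (‖γ₀‖⁻¹ • γ₀) μ) ∧
      TendstoC1Loc Ψ (𝓝[<] 0) (bubble S l γ₀) {0}ᶜ := by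
  have hm' : (2 : ℝ) ≤ m := by exact_mod_cast hm
  have hq0 : (0 : ℝ) ≤ 1 / ((m : ℝ) - 1) := one_div_nonneg.2 (by linarith)
  have hNpos : 0 < ‖γ₀‖ := by
    rw [hγ₀]
    positivity
  have hN2 : ‖γ₀‖ ^ 2 = ((m : ℝ) / 2) ^ (m - 1) / 2 := by
    have h1 : (((m : ℝ) / 2) ^ (((m : ℝ) - 1) / 2)) ^ 2 = ((m : ℝ) / 2) ^ (m - 1) := by
      rw [← Real.rpow_natCast, ← Real.rpow_natCast, ← Real.rpow_mul (by positivity),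
        Nat.cast_sub (by omega)]
      congr 1
      push_cast
      ring
    rw [hγ₀, mul_pow, h1, div_pow, Real.sq_sqrt (by norm_num)]
    ring
  have hex : ∀ μ : ℝ, ∃ (y : ℝ) (u v : ℝ → ℝ), μ ∈ parameterSet m →
      ((m : ℝ) - 1) / 2 ≤ y ∧ diagonalEnergy m y = μ ∧ IsPeriodicOrbit m μ u v ∧
        u 0 = -Real.sqrt (y ^ (m - 1) / 2) ∧ v 0 = -Real.sqrt (y ^ (m - 1) / 2) := by
    intro μ
    by_cases hμ : μ ∈ parameterSet m
    · obtain ⟨y, u, v, h⟩ := exists_isPeriodicOrbit hm hμ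
      exact ⟨y, u, v, fun _ => h⟩
    · exact ⟨0, 0, 0, fun h => absurd h hμ⟩
  choose y U V hUV using hex
  set k := Real.log l
  refine ⟨fun μ => logField S (‖γ₀‖⁻¹ • γ₀) (profileA m fun t => U μ (t + k))
    (profileB m fun t => V μ (t + k)), fun μ hμ => ?_, ?_⟩
  · obtain ⟨-, -, h, -⟩ := hUV μ hμ
    obtain ⟨T, hT, hu, hv⟩ := h.periodic
    exact mem_delaunayFamily_iff.2 ⟨_, _, (h.isOrbit.comp_add_const k).isPeriodicOrbit hT
      (fun t => (congrArg (U μ) (add_right_comm t T k)).trans (hu (t + k)))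
      (fun t => (congrArg (V μ) (add_right_comm t T k)).trans (hv (t + k))), fun x _ => rfl⟩
  have hy : Tendsto y (𝓝[<] 0) (𝓝 ((m : ℝ) / 2)) :=
    tendsto_diagonal hm fun μ hμ => ⟨(hUV μ hμ).1, (hUV μ hμ).2.1⟩
  have hstart : Tendsto (fun μ => -Real.sqrt (y μ ^ (m - 1) / 2)) (𝓝[<] 0) (𝓝 (-‖γ₀‖)) := by
    have := (((hy.pow (m - 1)).div_const 2).sqrt).neg
    rwa [← hN2, Real.sqrt_sq hNpos.le] at this
  have hmem := eventually_mem_parameterSet hm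
  have h₀ := homoclinic_isOrbit hm hN2
  have h0U : homoclinicU m ‖γ₀‖ 0 = -‖γ₀‖ := by simp [homoclinicU]
  have h0V : homoclinicV m ‖γ₀‖ 0 = -‖γ₀‖ := by simp [homoclinicV]
  have hconv := IsOrbit.tendsto_of_tendsto_zero hm (l := 𝓝[<] (0 : ℝ)) (μ := id) (U := U) (V := V)
    (R := 1)
    (by filter_upwards [hmem] with μ hμ using (hUV μ hμ).2.2.1.isOrbit)
    (by
      have : ∀ᶠ μ : ℝ in 𝓝 0, |μ| < 1 :=
        continuous_abs.continuousAt.eventually_lt continuousAt_const (by simp)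
      filter_upwards [nhdsWithin_le_nhds this] with μ hμ using hμ.le)
    h₀ (by simp)
    (by
      rw [h0U]
      refine hstart.congr' ?_
      filter_upwards [hmem] with μ hμ using (hUV μ hμ).2.2.2.1.symm)
    (by
      rw [h0V]
      refine hstart.congr' ?_
      filter_upwards [hmem] with μ hμ using (hUV μ hμ).2.2.2.2.symm)
  have hshift : ∀ t : ℝ, Tendsto (fun p : ℝ × ℝ => (p.1, p.2 + k)) (𝓝[<] 0 ×ˢ 𝓝 t)
      (𝓝[<] 0 ×ˢ 𝓝 (t + k)) := fun t =>
    tendsto_fst.prodMk (((continuous_add_const k).tendsto t).comp tendsto_snd)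
  have hU : ∀ t, Tendsto (fun p : ℝ × ℝ => U p.1 (p.2 + k)) (𝓝[<] 0 ×ˢ 𝓝 t)
      (𝓝 (homoclinicU m ‖γ₀‖ (t + k))) := fun t => (hconv (t + k)).1.comp (hshift t)
  have hV : ∀ t, Tendsto (fun p : ℝ × ℝ => V p.1 (p.2 + k)) (𝓝[<] 0 ×ˢ 𝓝 t)
      (𝓝 (homoclinicV m ‖γ₀‖ (t + k))) := fun t => (hconv (t + k)).2.comp (hshift t)
  have hexp : ∀ a t : ℝ, Tendsto (fun p : ℝ × ℝ => Real.exp (a * p.2)) (𝓝[<] 0 ×ˢ 𝓝 t)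
      (𝓝 (Real.exp (a * t))) := fun a t => by
    have hc : Continuous fun s : ℝ => Real.exp (a * s) := by fun_prop
    exact (hc.tendsto t).comp tendsto_snd
  have hρ := fun t => (((hU t).pow 2).add ((hV t).pow 2)).rpow_const
    (p := 1 / ((m : ℝ) - 1)) (Or.inr hq0)
  have hk := h₀.comp_add_const k
  have hcU := hk.continuous_u
  have hcV := hk.continuous_v
  have hcρ : Continuous fun t => (homoclinicU m ‖γ₀‖ (t + k) ^ 2
      + homoclinicV m ‖γ₀‖ (t + k) ^ 2) ^ (1 / ((m : ℝ) - 1)) :=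
    ((hcU.pow 2).add (hcV.pow 2)).rpow_const fun _ => Or.inr hq0
  exact tendstoC1Loc_logField
    (by filter_upwards [hmem] with μ hμ using
      ((hUV μ hμ).2.2.1.isOrbit.comp_add_const k).hasDerivAt_profileA)
    (by filter_upwards [hmem] with μ hμ using
      ((hUV μ hμ).2.2.1.isOrbit.comp_add_const k).hasDerivAt_profileB)
    hk.hasDerivAt_profileA hk.hasDerivAt_profileB
    ((hcρ.mul hcV).neg.mul (by fun_prop))
    (((continuous_const.mul hcV).sub (hcρ.mul hcU)).mul (by fun_prop))
    (fun t => (hU t).neg.mul (hexp _ t)) (fun t => (hV t).mul (hexp _ t))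
    (fun t => ((hρ t).mul (hV t)).neg.mul (hexp _ t))
    (fun t => (((hV t).const_mul _).sub ((hρ t).mul (hU t))).mul (hexp _ t))
    fun x hx => bubble_eq_logField hl (norm_pos_iff.1 hNpos) hx

end SpinorialYamabe


open SpinorialYamabe in
theorem corollary1p4 (m : ℕ) (hm : 2 ≤ m) (S : SpinRep m) :
    -- for every polarisation, the parameter set indexes a family of Delaunay-type fields,
    -- each of them a nonvanishing singular solution in the ansatz space with the stated growth
    (∀ γ : Spinor m, ‖γ‖ = 1 → ∀ μ ∈ parameterSet m,
      (delaunayFamily S γ μ).Nonempty ∧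
      ∀ ψ ∈ delaunayFamily S γ μ,
        ψ ∈ ansatzSpace S ∧ IsSolution S ψ ∧
        Tendsto (fun x => ‖ψ x‖) (𝓝[≠] 0) atTop ∧
        (∀ x, x ≠ 0 → ψ x ≠ 0) ∧
        (fun x => ‖ψ x‖) =O[Bornology.cobounded (Eucl m)]
          (fun x => ‖x‖ ^ (-(((m : ℝ) - 1) / 2))) ∧
        (fun x => ‖ψ x‖) =O[𝓝[≠] 0] (fun x => ‖x‖ ^ (-(((m : ℝ) - 1) / 2)))) ∧
    -- the parameter is determined by the field
    (∀ γ γ' : Spinor m, ‖γ‖ = 1 → ‖γ'‖ = 1 → ∀ μ ∈ parameterSet m, ∀ μ' ∈ parameterSet m,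
      ∀ ψ ∈ delaunayFamily S γ μ, ψ ∈ delaunayFamily S γ' μ' → μ = μ') ∧
    -- the parameter determines the field up to sign and dilation
    (∀ γ : Spinor m, ‖γ‖ = 1 → ∀ μ ∈ parameterSet m,
      ∀ ψ ∈ delaunayFamily S γ μ, ∀ ψ' ∈ delaunayFamily S γ μ,
        ∃ σ : ℝ, (σ = 1 ∨ σ = -1) ∧ ∃ ρ : ℝ, 0 < ρ ∧
          ∀ x, x ≠ 0 → ψ' x = (σ * ρ ^ (((m : ℝ) - 1) / 2)) • ψ (ρ • x)) ∧
    -- convergence to the bubble of any prescribed scale, away from the singularity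
    (∀ γ₀ : Spinor m, ‖γ₀‖ = 1 / Real.sqrt 2 * ((m : ℝ) / 2) ^ (((m : ℝ) - 1) / 2) →
      ∀ l : ℝ, 0 < l →
        ∃ Ψ : ℝ → Eucl m → Spinor m,
          (∀ μ ∈ parameterSet m, Ψ μ ∈ delaunayFamily S (‖γ₀‖⁻¹ • γ₀) μ) ∧
          TendstoC1Loc Ψ (𝓝[<] 0) (bubble S l γ₀) {0}ᶜ) := by
  refine ⟨fun γ hγ μ hμ => ⟨?_, fun ψ hψ => ?_⟩, ?_, ?_, ?_⟩
  · obtain ⟨-, u, v, -, -, h, -⟩ := exists_isPeriodicOrbit hm hμ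
    exact ⟨_, mem_delaunayFamily_iff.2 ⟨u, v, h, fun x _ => rfl⟩⟩
  · obtain ⟨u, v, h, hψ⟩ := mem_delaunayFamily_iff.1 hψ
    obtain ⟨a, ha, b, hab⟩ := exists_norm_bounds hm hγ h hμ.2 hψ
    exact ⟨mem_ansatzSpace_of_isOrbit hm hγ h.isOrbit hμ.2 hψ,
      isSolution_of_isOrbit hm hγ h.isOrbit hμ.2 hψ, asymptotics_of_norm_bounds hm ha hab⟩
  · exact fun γ γ' hγ hγ' μ hμ μ' hμ' ψ h h' => energy_unique hm hγ hγ' hμ.2 hμ'.2 h h'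
  · exact fun γ hγ μ hμ ψ h ψ' h' => exists_sign_dilation hm hμ.2 h h'
  · exact fun γ₀ hγ₀ l hl => exists_tendsto_bubble hm S hγ₀ hl
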